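/- Let $k,q\ge 1$ be integers and let $\pi=(\pi(y|x))_{x,y\in\{1,\dots,q\}}$ be a transition kernel ($\pi(y|x)\ge 0$, $\sum_y\pi(y|x)=1$) which is reversible with respect to the uniform distribution, i.e. $\pi(y|x)=\pi(x|y)$, and irreducible. On the infinite rooted $k$-ary tree (every vertex has $k$ children), with $V_\ell$ the set of vertices of generation $\ell$, consider the broadcast process: the root color $X_0$ is uniform in $\{1,\dots,q\}$ and, given the colors of the generations $0,\dots,\ell$, the colors of generation $\ell+1$ are independent, a child of a vertex of color $y$ having color $z$ with probability $\pi(z|y)$. Let $\underline X_\ell$ be the color configuration on $V_\ell$ and let $\eta_\ell(y)=\mathbb P[X_0=y\,|\,\underline X_\ell]$, a random element of the simplex $\mathfrak M_q$ of probability distributions on $\{1,\dots,q\}$. The reconstruction problem is *solvable* if $I_\infty=\lim_{\ell\to\infty}I(X_0;\underline X_\ell)$ exists and is $>0$, where $I$ is the mutual information in bits. For $\eta_1,\dots,\eta_k\in\mathfrak M_q$ let $z(\eta_1,\dots,\eta_k)=\sum_y\prod_{i=1}^k\sum_{y_i}\pi(y_i|y)\eta_i(y_i)$ and, when $z\neq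 0$, let $\mathsf F(\eta_1,\dots,\eta_k)\in\mathfrak M_q$ be $\mathsf F(\eta_1,\dots,\eta_k)(y)=z^{-1}\prod_{i=1}^k\sum_{y_i}\pi(y_i|y)\eta_i(y_i)$ (and, say, the uniform distribution when $z=0$). A probability measure $\widehat Q$ on $\mathfrak M_q$ solves the $m=1$ 1RSB fixed-point equation if $$\widehat Q(\eta)=q^{k-1}\int z(\eta_1,\dots,\eta_k)\,\delta[\eta-\mathsf F(\eta_1,\dots,\eta_k)]\prod_{i=1}^k d\widehat Q(\eta_i),$$ i.e. $\widehat Q$ is the image under $\mathsf F$ of the measure $q^{k-1}z\,d\widehat Q^{\otimes k}$. It is *trivial* if it is the point mass at the uniform distribution. The pair $(k,\pi)$ *admits a glass phase* if this equation has a non-trivial solution. Then: 1. $(k,\pi)$ admits a glass phase if and only if the reconstruction problem is solvable. 2. The posterior $\eta_\ell$ converges almost surely, as $\ell\to\infty$, to a random element $\eta_\infty$ of $\mathfrak M_q$; the law of $\eta_\infty$ solves the fixed-point equation, and it is non-trivial if the reconstruction problem is solvable. 3. Let $\widehat Q^*$ be a non-trivial solution, and put $Q^*_x(d\eta)=q\,\eta(x)\,\widehat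 Q^*(d\eta)$. Consider the following randomized reconstruction scheme: given $\underline X_\ell=(x_v)_{v\in V_\ell}$, draw independently $\eta_v\sim Q^*_{x_v}$ for $v\in V_\ell$; generation by generation down to the root, assign to each vertex $a$ with children $a_1,\dots,a_k$ the distribution $\eta_a=\mathsf F(\eta_{a_1},\dots,\eta_{a_k})$; guess for the root color a letter drawn from the distribution $\eta_0$ obtained at the root. This scheme is well defined (all laws involved are probability measures), and for every $\ell\ge 0$ its probability of guessing $X_0$ correctly equals $\sum_x\int\eta(x)^2\,d\widehat Q^*(\eta)$, which is independent of $\ell$ and strictly larger than $1/q$. -/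

import Mathlib

open MeasureTheory ProbabilityTheory Filter Topology

noncomputable section

namespace TreeRecon

/-! ### Channels and the broadcast process on the `k`-ary tree -/

/-- A noisy channel (transition kernel) on the alphabet `Fin q`: a row-stochastic matrix `π`,
where `π.1 x y` is the probability `π(y|x)` that `y` is received when `x` is transmitted. -/
abbrev Channel (q : ℕ) : Type := ↥(Matrix.rowStochastic ℝ (Fin q))

/-- The law `π(·|x)` of the letter received when `x` is transmitted. -/
def Channel.out {q : ℕ} (π : Channel q) (x : Fin q) : Measure (Fin q) :=
  ∑ y, ENNReal.ofReal (π.1 x y) • Measure.dirac y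

instance {q : ℕ} (π : Channel q) (x : Fin q) : IsProbabilityMeasure (π.out x) := by
  refine ⟨?_⟩
  have h1 := congrFun π.2.2 x
  simp only [Matrix.mulVec, dotProduct, Pi.one_apply, mul_one] at h1
  simp only [Channel.out, Measure.finsetSum_apply, Measure.smul_apply, measure_univ, smul_eq_mul,
    mul_one]
  rw [← ENNReal.ofReal_sum_of_nonneg (fun y _ => π.2.1 x y)]
  exact h1 ▸ ENNReal.ofReal_one

/-- Vertices of generation `ℓ` of the infinite rooted `k`-ary tree: words of length `ℓ` over
`Fin k`. The root is the empty word, the children of `v` are the words `Fin.snoc v i`, and the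
parent of a vertex `w` of positive generation is `Fin.init w`. -/
abbrev Vertex (k ℓ : ℕ) : Type := Fin ℓ → Fin k

/-- Colour configurations on generation `ℓ`. -/
abbrev Config (q k ℓ : ℕ) : Type := Vertex k ℓ → Fin q

/-- One step of the broadcast: given the configurations of the generations `0, …, n`, the colours
of the vertices of generation `n + 1` are independent, and the colour of `w` has law
`π(·|colour of the parent of w)`. -/
def broadcastStep {q : ℕ} (k : ℕ) (π : Channel q) (n : ℕ) :
    Kernel (Π i : Finset.Iic n, Config q k i) (Config q k (n + 1)) :=
  Kernel.ofFunOfCountable fun x =>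
    Measure.pi fun w : Vertex k (n + 1) =>
      π.out (x ⟨n, Finset.mem_Iic.2 le_rfl⟩ (fun j : Fin n => w j.castSucc))

instance {q : ℕ} (k : ℕ) (π : Channel q) (n : ℕ) : IsMarkovKernel (broadcastStep k π n) :=
  ⟨fun x => by
    change IsProbabilityMeasure (Measure.pi _)
    infer_instance⟩

/-- The law of the configuration of generation `0`: the root colour is uniformly random. -/
def rootLaw (q k : ℕ) [NeZero q] : Measure (Config q k 0) :=
  (PMF.uniformOfFintype (Fin q)).toMeasure.map (fun x _ => x)

instance (q k : ℕ) [NeZero q] : IsProbabilityMeasure (rootLaw q k) :=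
  Measure.isProbabilityMeasure_map (by fun_prop)

/-- The law of the broadcast process `(X_0, X_1, X_2, …)`, where `X_ℓ` is the colour configuration
of generation `ℓ`, on its canonical sample space. -/
def broadcast {q : ℕ} [NeZero q] (k : ℕ) (π : Channel q) : Measure (Π n, Config q k n) :=
  Kernel.trajMeasure (rootLaw q k) (broadcastStep k π)

instance {q : ℕ} [NeZero q] (k : ℕ) (π : Channel q) : IsProbabilityMeasure (broadcast k π) := by
  unfold broadcast
  infer_instance

/-- The colour of the root, i.e. the transmitted letter. -/
def rootColor {q k : ℕ} (ω : Π n, Config q k n) : Fin q := ω 0 Fin.elim0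

/-! ### The posterior of the root and solvability of reconstruction -/

/-- Probability distributions on the alphabet. -/
abbrev Simplex (q : ℕ) : Type := ↥(stdSimplex ℝ (Fin q))

/-- The uniform distribution on the alphabet. -/
def unif (q : ℕ) [NeZero q] : Simplex q :=
  ⟨fun _ => 1 / (q : ℝ), fun _ => by positivity, by
    simp [Finset.sum_const, NeZero.ne q]⟩

/-- The event that the configuration of generation `ℓ` is `c`. -/
def levelEvent {q k : ℕ} (ℓ : ℕ) (c : Config q k ℓ) : Set (Π n, Config q k n) := {ω | ω ℓ = c}

lemma rootPosterior_mem {q : ℕ} [NeZero q] (k : ℕ) (π : Channel q) (ℓ : ℕ) (c : Config q k ℓ)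
    (h : broadcast k π (levelEvent ℓ c) ≠ 0) :
    (fun y => ((broadcast k π)[|levelEvent ℓ c]).real {ω | rootColor ω = y})
      ∈ stdSimplex ℝ (Fin q) := by
  refine ⟨fun y => measureReal_nonneg, ?_⟩
  have : IsProbabilityMeasure ((broadcast k π)[|levelEvent ℓ c]) := cond_isProbabilityMeasure h
  have hm : Measurable (rootColor : (Π n, Config q k n) → Fin q) := by
    unfold rootColor
    fun_prop
  have hu := measureReal_biUnion_finset (μ := (broadcast k π)[|levelEvent ℓ c])
    (s := Finset.univ) (f := fun y : Fin q => {ω : Π n, Config q k n | rootColor ω = y})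
    (fun a _ b _ hab => Set.disjoint_left.2 fun ω h1 h2 => hab (h1.symm.trans h2))
    (fun y _ => hm (measurableSet_singleton y))
  rw [← hu]
  convert probReal_univ (μ := (broadcast k π)[|levelEvent ℓ c])
  ext ω
  simp

open Classical in
/-- The posterior distribution `y ↦ ℙ[X_0 = y | X_ℓ = c]` of the root colour given the
configuration `c` of generation `ℓ` (by convention uniform if `c` has probability zero). -/
def rootPosterior {q : ℕ} [NeZero q] (k : ℕ) (π : Channel q) (ℓ : ℕ) (c : Config q k ℓ) :
    Simplex q :=
  if h : broadcast k π (levelEvent ℓ c) = 0 then unif q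
  else ⟨fun y => ((broadcast k π)[|levelEvent ℓ c]).real {ω | rootColor ω = y},
    rootPosterior_mem k π ℓ c h⟩

/-- The mutual information `I(X_0; X_ℓ)`, in bits, between the root colour and the
configuration of generation `ℓ`. -/
def mutualInfo {q : ℕ} [NeZero q] (k : ℕ) (π : Channel q) (ℓ : ℕ) : ℝ :=
  ∑ x : Fin q, ∑ c : Config q k ℓ,
    (broadcast k π).real ({ω | rootColor ω = x} ∩ levelEvent ℓ c) *
      Real.logb 2 ((broadcast k π).real ({ω | rootColor ω = x} ∩ levelEvent ℓ c) /
        ((broadcast k π).real {ω | rootColor ω = x} * (broadcast k π).real (levelEvent ℓ c)))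

/-- The reconstruction problem is solvable if `I_∞ = lim I(X_0; X_ℓ)` is positive. -/
def Solvable {q : ℕ} [NeZero q] (k : ℕ) (π : Channel q) : Prop :=
  ∃ I : ℝ, 0 < I ∧ Tendsto (mutualInfo k π) atTop (𝓝 I)

/-! ### The one-step replica symmetry breaking equation at `m = 1` -/

/-- `y ↦ ∏_i ∑_{y_i} π(y_i|y) η_i(y_i)`. -/
def mergeWeight {q k : ℕ} (π : Channel q) (η : Fin k → Simplex q) (y : Fin q) : ℝ :=
  ∏ i, ∑ y', π.1 y y' * (η i).1 y'

/-- The normalization `z({η_i}) = ∑_y ∏_i ∑_{y_i} π(y_i|y) η_i(y_i)`. -/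
def mergeZ {q k : ℕ} (π : Channel q) (η : Fin k → Simplex q) : ℝ := ∑ y, mergeWeight π η y

lemma mergeWeight_nonneg {q k : ℕ} (π : Channel q) (η : Fin k → Simplex q) (y : Fin q) :
    0 ≤ mergeWeight π η y :=
  Finset.prod_nonneg fun i _ => Finset.sum_nonneg fun y' _ => mul_nonneg (π.2.1 y y') ((η i).2.1 y')

open Classical in
/-- The merging map `F(η_1, …, η_k)(y) = z⁻¹ ∏_i ∑_{y_i} π(y_i|y) η_i(y_i)` (by convention
uniform if `z = 0`; such arguments carry no mass below). -/
def merge {q k : ℕ} [NeZero q] (π : Channel q) (η : Fin k → Simplex q) : Simplex q :=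
  if h : mergeZ π η = 0 then unif q
  else ⟨fun y => mergeWeight π η y / mergeZ π η,
    fun y => div_nonneg (mergeWeight_nonneg π η y)
      (Finset.sum_nonneg fun y _ => mergeWeight_nonneg π η y), by
    rw [← Finset.sum_div]
    exact div_self h⟩

/-- `Q` solves `Q(η) = q^{k-1} ∫ z({η_i}) δ[η - F(η_1, …, η_k)] ∏_i dQ(η_i)`: it is the
push-forward under `F` of the measure with density `q^{k-1} z` with respect to the `k`-fold
product of `Q`. -/
def IsFixedPoint {q : ℕ} [NeZero q] (k : ℕ) (π : Channel q) (Q : Measure (Simplex q)) : Prop :=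
  Q = ((Measure.pi fun _ : Fin k => Q).withDensity
        fun η => ENNReal.ofReal ((q : ℝ) ^ (k - 1) * mergeZ π η)).map (merge π)

/-- A distribution on the simplex is trivial if it is the point mass at the uniform
distribution. -/
def IsTrivial {q : ℕ} [NeZero q] (Q : Measure (Simplex q)) : Prop := Q = Measure.dirac (unif q)

/-- The model associated with `k, π` admits a glass phase. -/
def AdmitsGlassPhase {q : ℕ} [NeZero q] (k : ℕ) (π : Channel q) : Prop :=
  ∃ Q : Measure (Simplex q), IsProbabilityMeasure Q ∧ IsFixedPoint k π Q ∧ ¬ IsTrivial Q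

/-! ### Randomized reconstruction from a solution of the fixed-point equation -/

/-- The conditional distribution `Q_x(η) = q η(x) Q(η)`. -/
def tilt {q : ℕ} (Q : Measure (Simplex q)) (x : Fin q) : Measure (Simplex q) :=
  Q.withDensity fun η => ENNReal.ofReal ((q : ℝ) * η.1 x)

/-- From a distribution at every vertex of generation `ℓ`, compute a distribution at the root by
applying the merging map `F` generation by generation. -/
def mergeToRoot {q k : ℕ} [NeZero q] (π : Channel q) :
    (ℓ : ℕ) → (Vertex k ℓ → Simplex q) → Simplex q
  | 0, m => m Fin.elim0
  | ℓ + 1, m => mergeToRoot π ℓ fun v => merge π fun i =>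
      m (Fin.snoc (α := fun _ => Fin k) v i)

/-- The law `∑_y η(y) δ_y` of a random letter drawn from `η`. -/
def draw {q : ℕ} (η : Simplex q) : Measure (Fin q) :=
  ∑ y, ENNReal.ofReal (η.1 y) • Measure.dirac y

/-- The randomized reconstruction scheme built on `Q`: given the received configuration `c`, draw
independently `η_v` from `Q_{c v}` for each vertex `v` of generation `ℓ`, merge down to the root to
get `η_0`, and guess a letter drawn from `η_0`. This is the law of the guess. -/
def guessLaw {q k : ℕ} [NeZero q] (π : Channel q) (Q : Measure (Simplex q)) (ℓ : ℕ)
    (c : Config q k ℓ) : Measure (Fin q) :=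
  (Measure.pi fun v => tilt Q (c v)).bind fun m => draw (mergeToRoot π ℓ m)

/-- The probability that a randomized guess, of law `κ c` when the configuration of generation `ℓ`
is `c`, equals the transmitted letter. -/
def successProb {q : ℕ} [NeZero q] (k : ℕ) (π : Channel q) (ℓ : ℕ)
    (κ : Config q k ℓ → Measure (Fin q)) : ℝ :=
  ∫ ω, (κ (ω ℓ)).real {rootColor ω} ∂(broadcast k π)

end TreeRecon

end

open TreeRecon

/-!
A solution `Q` of the fixed-point equation and the law of the posterior of the root given a far away
generation are two sides of the same object.

*The posterior.* The broadcast process is a Markov chain, so the posterior given generation `ℓ` is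
also the posterior given all the later generations, and the sequence of posteriors is a martingale
when time runs backwards (`integral_posteriorAt_mul`, `martingale_posteriorAt`). Its second moments
decrease, so it is Cauchy in `L²`, and Doob's maximal inequality gives almost sure convergence to
some `η_∞` (`exists_posterior_limit`). Given the root colour, the subtrees at the children of the
root are independent broadcast processes (`levelLaw_succ_configSplit`), so Bayes' rule turns the law
of the posterior at generation `ℓ` into that at generation `ℓ + 1` by the map
`Q ↦ F_*(q ^ (k - 1) z Q^⊗k)` (`integral_rootPosterior_succ`). Since `z · (g ∘ F)` is continuous for
every bounded continuous `g`, the law of `η_∞` is a fixed point (`isFixedPoint_map_limit`).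

*Mutual information.* `I(X_0; X_ℓ)` is the mean relative entropy of the posterior with respect to
the uniform distribution (`mutualInfo_eq_integral`); it converges to the mean relative entropy of
`η_∞`, which vanishes only if `η_∞` is almost surely uniform. So reconstruction is solvable exactly
when the law of `η_∞` is nontrivial (`solvable_iff`), and then this law is a nontrivial fixed point.

*The scheme.* A fixed point `Q` has uniform mean (`fixedPoint_mean`), so the tilted measures `Q_x`
are probability measures. Conditioned on the colour `x` of a vertex, the fixed-point equation says
that merging independent draws at its children gives a draw from `Q_x` (`map_merge_pi_childTilt`).
By induction on the generation the distribution computed at the root has law `Q_x` given `X_0 = x`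
(`sum_levelLaw_lintegral_mergeToRoot`), which gives the success probability
`∑ x, ∫ η x ^ 2 ∂Q`. It exceeds `1 / q` by the mean squared distance of `η` to the uniform
distribution. If `η_∞` were uniform, the success probability of any guesses would tend to `1 / q`
(`tendsto_successProb`); hence a nontrivial fixed point makes reconstruction solvable.
-/

namespace TreeRecon

/-! ### The joint law of the root and of a generation -/

/-- The probability that generation `n + 1` has configuration `c`, given that generation `n` has
configuration `b`. -/
noncomputable def levelStep {q k : ℕ} (π : Channel q) (n : ℕ) (b : Config q k n)
    (c : Config q k (n + 1)) : ℝ :=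
  ∏ w, π.1 (b (fun j => w j.castSucc)) (c w)

/-- The probability that generation `ℓ` has configuration `c`, given that the root has colour
`x`. -/
noncomputable def levelLaw {q k : ℕ} (π : Channel q) : (ℓ : ℕ) → Fin q → Config q k ℓ → ℝ
  | 0, x, c => if c = fun _ => x then 1 else 0
  | ℓ + 1, x, c => ∑ b, levelLaw π ℓ x b * levelStep π ℓ b c

lemma levelStep_nonneg {q k : ℕ} (π : Channel q) (n : ℕ) (b : Config q k n)
    (c : Config q k (n + 1)) : 0 ≤ levelStep π n b c :=
  Finset.prod_nonneg fun _ _ => π.2.1 _ _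

lemma levelLaw_nonneg {q k : ℕ} (π : Channel q) (ℓ : ℕ) (x : Fin q) (c : Config q k ℓ) :
    0 ≤ levelLaw π ℓ x c := by
  induction ℓ with
  | zero => simp only [levelLaw]; split_ifs <;> norm_num
  | succ ℓ ih =>
    exact Finset.sum_nonneg fun b _ => mul_nonneg (ih b) (levelStep_nonneg π ℓ b c)

lemma channel_sum_row {q : ℕ} (π : Channel q) (x : Fin q) : ∑ y, π.1 x y = 1 := by
  have h1 := congrFun π.2.2 x
  simpa only [Matrix.mulVec, dotProduct, Pi.one_apply, mul_one] using h1

lemma out_singleton {q : ℕ} (π : Channel q) (x y : Fin q) :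
    π.out x {y} = ENNReal.ofReal (π.1 x y) := by
  simp only [Channel.out, Measure.finsetSum_apply, Measure.smul_apply, smul_eq_mul]
  rw [Finset.sum_eq_single y]
  · simp
  · intro z _ hz
    simp [Measure.dirac_apply' _ (measurableSet_singleton y), hz]
  · simp

lemma broadcastStep_real_singleton {q k : ℕ} (π : Channel q) (n : ℕ)
    (r : Π i : Finset.Iic n, Config q k i) (c : Config q k (n + 1)) :
    (broadcastStep k π n r).real {c}
      = levelStep π n (r ⟨n, Finset.mem_Iic.2 le_rfl⟩) c := by
  change (Measure.pi _).real {c} = _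
  rw [measureReal_def, Measure.pi_singleton, ENNReal.toReal_prod]
  refine Finset.prod_congr rfl fun w _ => ?_
  rw [out_singleton, ENNReal.toReal_ofReal (π.2.1 _ _)]

/-- Conditioning on the generations `0, …, n`: the next one has law `levelStep`. -/
lemma integral_broadcast_frestrictLe {q k : ℕ} [NeZero q] (π : Channel q) (n : ℕ)
    (F : (Π i : Finset.Iic n, Config q k i) → Config q k (n + 1) → ℝ) :
    ∫ ω, F (Preorder.frestrictLe n ω) (ω (n + 1)) ∂(broadcast k π)
      = ∫ ω, ∑ c, levelStep π n (ω n) c * F (Preorder.frestrictLe n ω) c ∂(broadcast k π) := by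
  have h := Kernel.map_frestrictLe_trajMeasure_compProd_eq_map_trajMeasure
    (μ₀ := rootLaw q k) (κ := broadcastStep k π) (a := n)
  change (broadcast k π).map _ ⊗ₘ _ = (broadcast k π).map _ at h
  have hm : Measurable (fun ω : Π n, Config q k n => (Preorder.frestrictLe n ω, ω (n + 1))) := by
    fun_prop
  have hp : IsProbabilityMeasure ((broadcast k π).map
      (Preorder.frestrictLe (π := fun n => Config q k n) n)) :=
    Measure.isProbabilityMeasure_map (by fun_prop)
  have e1 : ∫ ω, F (Preorder.frestrictLe n ω) (ω (n + 1)) ∂(broadcast k π)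
      = ∫ p, F p.1 p.2 ∂((broadcast k π).map
        (fun ω : Π n, Config q k n => (Preorder.frestrictLe n ω, ω (n + 1)))) := by
    rw [integral_map hm.aemeasurable Measurable.of_discrete.aestronglyMeasurable]
  rw [e1, ← h, Measure.integral_compProd Integrable.of_finite,
    integral_map (by fun_prop) Measurable.of_discrete.aestronglyMeasurable]
  refine integral_congr_ae (.of_forall fun ω => ?_)
  dsimp only
  rw [integral_fintype Integrable.of_finite]
  refine Finset.sum_congr rfl fun c _ => ?_
  rw [broadcastStep_real_singleton, smul_eq_mul]
  rfl

lemma map_zero_broadcast {q k : ℕ} [NeZero q] (π : Channel q) :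
    (broadcast k π).map (fun ω => ω 0) = rootLaw q k := by
  have h : (fun ω : Π n, Config q k n => ω 0)
      = (fun r : Π i : Finset.Iic 0, Config q k i => r ⟨0, Finset.mem_Iic.2 le_rfl⟩)
        ∘ Preorder.frestrictLe 0 := rfl
  rw [h, ← Measure.map_map (by fun_prop) (by fun_prop), broadcast, Kernel.trajMeasure,
    Measure.map_comp _ _ (by fun_prop), Kernel.traj_map_frestrictLe, Kernel.partialTraj_self,
    Measure.id_comp]
  refine (Measure.map_map (μ := rootLaw q k) (measurable_pi_apply _)
    (MeasurableEquiv.measurable _)).trans ?_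
  exact Measure.map_id

lemma integral_comp_root {q k : ℕ} [NeZero q] (π : Channel q) (g : Config q k 0 → ℝ) :
    ∫ ω, g (ω 0) ∂(broadcast k π) = ∑ x, (1 / (q : ℝ)) * g (fun _ => x) := by
  have : ∫ ω, g (ω 0) ∂(broadcast k π) = ∫ c, g c ∂(rootLaw q k) := by
    rw [← map_zero_broadcast π, integral_map (measurable_pi_apply 0).aemeasurable
      Measurable.of_discrete.aestronglyMeasurable]
  rw [this, rootLaw, integral_map (by fun_prop) Measurable.of_discrete.aestronglyMeasurable,
    integral_fintype Integrable.of_finite]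
  refine Finset.sum_congr rfl fun x _ => ?_
  rw [measureReal_def, PMF.toMeasure_apply_singleton _ _ (measurableSet_singleton x)]
  simp

/-- Joint law of the root colour and of the configuration of generation `ℓ`. -/
lemma integral_root_level {q k : ℕ} [NeZero q] (π : Channel q) (ℓ : ℕ)
    (g : Fin q → Config q k ℓ → ℝ) :
    ∫ ω, g (rootColor ω) (ω ℓ) ∂(broadcast k π)
      = ∑ x, ∑ c, (1 / (q : ℝ)) * levelLaw π ℓ x c * g x c := by
  induction ℓ with
  | zero =>
    refine (integral_comp_root π fun c => g (c Fin.elim0) c).trans ?_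
    refine Finset.sum_congr rfl fun x _ => ?_
    rw [Finset.sum_eq_single (fun _ => x)]
    · simp [levelLaw]
    · intro c _ hc
      simp [levelLaw, hc]
    · simp
  | succ ℓ ih =>
    have h0 := integral_broadcast_frestrictLe (k := k) π ℓ
      (fun r c => g (r ⟨0, Finset.mem_Iic.2 (Nat.zero_le _)⟩ Fin.elim0) c)
    have h1 := ih (fun x b => ∑ c, levelStep π ℓ b c * g x c)
    refine (h0.trans h1).trans ?_
    refine Finset.sum_congr rfl fun x _ => ?_
    simp_rw [levelLaw, Finset.mul_sum, Finset.sum_mul]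
    rw [Finset.sum_comm]
    refine Finset.sum_congr rfl fun c _ => Finset.sum_congr rfl fun b _ => ?_
    ring

/-! ### The posterior of the root -/

/-- The probability that generation `ℓ` has configuration `c`. -/
noncomputable def levelProb {q k : ℕ} (π : Channel q) (ℓ : ℕ) (c : Config q k ℓ) : ℝ :=
  ∑ x, (1 / (q : ℝ)) * levelLaw π ℓ x c

lemma measurable_rootColor {q k : ℕ} : Measurable (rootColor : (Π n, Config q k n) → Fin q) := by
  unfold rootColor
  fun_prop

lemma measurableSet_levelEvent {q k : ℕ} (ℓ : ℕ) (c : Config q k ℓ) :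
    MeasurableSet (levelEvent ℓ c) :=
  measurable_pi_apply ℓ (measurableSet_singleton c)

lemma measurableSet_rootColor_eq {q k : ℕ} (x : Fin q) :
    MeasurableSet {ω : Π n, Config q k n | rootColor ω = x} :=
  measurable_rootColor (measurableSet_singleton x)

lemma integral_level {q k : ℕ} [NeZero q] (π : Channel q) (ℓ : ℕ) (g : Config q k ℓ → ℝ) :
    ∫ ω, g (ω ℓ) ∂(broadcast k π) = ∑ c, levelProb π ℓ c * g c := by
  rw [integral_root_level π ℓ (fun _ c => g c), Finset.sum_comm]
  simp_rw [levelProb, Finset.sum_mul]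

lemma real_root_inter_level {q k : ℕ} [NeZero q] (π : Channel q) (ℓ : ℕ) (x : Fin q)
    (c : Config q k ℓ) :
    (broadcast k π).real ({ω | rootColor ω = x} ∩ levelEvent ℓ c)
      = (1 / (q : ℝ)) * levelLaw π ℓ x c := by
  classical
  rw [← integral_indicator_one
    ((measurableSet_rootColor_eq x).inter (measurableSet_levelEvent ℓ c))]
  have h := integral_root_level π ℓ (fun y b => if y = x ∧ b = c then (1 : ℝ) else 0)
  rw [Finset.sum_eq_single x, Finset.sum_eq_single c] at h
  · simp only [and_self, if_true, mul_one] at h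
    rw [← h]
    refine integral_congr_ae (.of_forall fun ω => ?_)
    simp [Set.indicator_apply, levelEvent]
  · intro b _ hb; simp [hb]
  · simp
  · intro y _ hy; simp [hy]
  · simp

lemma real_level {q k : ℕ} [NeZero q] (π : Channel q) (ℓ : ℕ) (c : Config q k ℓ) :
    (broadcast k π).real (levelEvent ℓ c) = levelProb π ℓ c := by
  classical
  rw [← integral_indicator_one (measurableSet_levelEvent ℓ c)]
  have h := integral_level π ℓ (fun b => if b = c then (1 : ℝ) else 0)
  rw [Finset.sum_eq_single c] at h
  · simp only [if_true, mul_one] at h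
    rw [← h]
    refine integral_congr_ae (.of_forall fun ω => ?_)
    simp [Set.indicator_apply, levelEvent]
  · intro b _ hb; simp [hb]
  · simp

lemma levelLaw_eq_zero {q k : ℕ} [NeZero q] (π : Channel q) (ℓ : ℕ) (c : Config q k ℓ)
    (h : levelProb π ℓ c = 0) (x : Fin q) : levelLaw π ℓ x c = 0 := by
  have h1 := (Finset.sum_eq_zero_iff_of_nonneg fun x _ =>
    mul_nonneg (by positivity) (levelLaw_nonneg π ℓ x c)).1 h x (Finset.mem_univ x)
  have hq : (1 / (q : ℝ)) ≠ 0 := by simp [NeZero.ne q]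
  exact (mul_eq_zero.1 h1).resolve_left hq

lemma measurable_rootPosterior {q k : ℕ} [NeZero q] (π : Channel q) (ℓ : ℕ) :
    Measurable fun ω : Π n, Config q k n => rootPosterior k π ℓ (ω ℓ) :=
  (Measurable.of_discrete (f := rootPosterior k π ℓ)).comp (measurable_pi_apply ℓ)

/-- Bayes' rule for the root colour. -/
lemma levelProb_mul_rootPosterior {q k : ℕ} [NeZero q] (π : Channel q) (ℓ : ℕ)
    (c : Config q k ℓ) (x : Fin q) :
    levelProb π ℓ c * (rootPosterior k π ℓ c).1 x = (1 / (q : ℝ)) * levelLaw π ℓ x c := by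
  by_cases h : levelProb π ℓ c = 0
  · rw [h, levelLaw_eq_zero π ℓ c h]; simp
  · have h' : broadcast k π (levelEvent ℓ c) ≠ 0 := by
      intro h0
      apply h
      rw [← real_level, measureReal_def, h0, ENNReal.toReal_zero]
    rw [rootPosterior, dif_neg h']
    dsimp only
    rw [measureReal_def, cond_apply (measurableSet_levelEvent ℓ c), ENNReal.toReal_mul,
      ENNReal.toReal_inv, ← measureReal_def, ← measureReal_def, real_level, Set.inter_comm,
      real_root_inter_level]
    field_simp

/-- Functions of the root colour and of generation `ℓ` may be averaged against the posterior. -/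
lemma integral_root_eq_integral_posterior {q k : ℕ} [NeZero q] (π : Channel q) (ℓ : ℕ)
    (g : Fin q → Config q k ℓ → ℝ) :
    ∫ ω, g (rootColor ω) (ω ℓ) ∂(broadcast k π)
      = ∫ ω, ∑ x, (rootPosterior k π ℓ (ω ℓ)).1 x * g x (ω ℓ) ∂(broadcast k π) := by
  rw [integral_root_level, integral_level π ℓ
    (fun c => ∑ x, (rootPosterior k π ℓ c).1 x * g x c), Finset.sum_comm]
  refine Finset.sum_congr rfl fun c _ => ?_
  rw [Finset.mul_sum]
  refine Finset.sum_congr rfl fun x _ => ?_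
  rw [← levelProb_mul_rootPosterior]
  ring

/-! ### Decomposition at the root -/

/-- A word of length `n + 1` is its first letter followed by a word of length `n`, so that a
configuration of generation `n + 1` consists of one configuration of generation `n` for each of the
subtrees rooted at the children of the root. -/
def configSplit (q k n : ℕ) : (Fin k → Config q k n) ≃ Config q k (n + 1) :=
  (Equiv.curry (Fin k) (Vertex k n) (Fin q)).symm.trans
    ((Fin.consEquiv fun _ : Fin (n + 1) => Fin k).arrowCongr (Equiv.refl _))

lemma configSplit_cons {q k n : ℕ} (b : Fin k → Config q k n) (i : Fin k) (v : Vertex k n) :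
    configSplit q k n b (Fin.cons (α := fun _ => Fin k) i v) = b i v := by
  simp [configSplit, Equiv.arrowCongr]

lemma levelStep_configSplit {q k n : ℕ} (π : Channel q) (b : Fin k → Config q k n)
    (c : Fin k → Config q k (n + 1)) :
    levelStep π (n + 1) (configSplit q k n b) (configSplit q k (n + 1) c)
      = ∏ i, levelStep π n (b i) (c i) := by
  simp only [levelStep]
  rw [← Fintype.prod_prod_type', ← (Fin.consEquiv fun _ : Fin (n + 2) => Fin k).prod_comp]
  refine Finset.prod_congr rfl fun p _ => ?_
  obtain ⟨i, v⟩ := p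
  refine congrArg₂ (fun y z => π.1 y z) ?_ (configSplit_cons c i v)
  refine Eq.trans (congrArg _ ?_) (configSplit_cons b i fun j => v j.castSucc)
  funext j
  refine Fin.cases rfl (fun j => rfl) j

/-- The subtrees rooted at the children of the root carry, given the colour of the root,
independent broadcast processes. -/
lemma levelLaw_succ_configSplit {q k : ℕ} (π : Channel q) (n : ℕ) (x : Fin q)
    (c : Fin k → Config q k n) :
    levelLaw π (n + 1) x (configSplit q k n c) = ∏ i, ∑ y, π.1 x y * levelLaw π n y (c i) := by
  induction n with
  | zero =>
    rw [levelLaw, Finset.sum_eq_single (fun _ => x)]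
    · simp only [levelLaw, if_true, one_mul, levelStep]
      rw [← (Fin.consEquiv fun _ : Fin 1 => Fin k).prod_comp, Fintype.prod_prod_type]
      refine Finset.prod_congr rfl fun i _ => ?_
      rw [Fintype.prod_unique, Finset.sum_eq_single (c i default)]
      · rw [if_pos (funext fun v => by rw [Subsingleton.elim v default]), mul_one]
        exact congrArg (fun z => π.1 x z) (configSplit_cons c i default)
      · intro y _ hy
        rw [if_neg, mul_zero]
        intro h
        exact hy (congrFun h default).symm
      · simp
    · intro b _ hb
      simp [levelLaw, hb]
    · simp
  | succ n ih =>
    rw [levelLaw, ← (configSplit q k n).sum_comp]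
    simp_rw [ih, levelStep_configSplit, ← Finset.prod_mul_distrib]
    rw [← Fintype.piFinset_univ, ← Finset.prod_univ_sum
      (fun _ : Fin k => (Finset.univ : Finset (Config q k n)))
      (fun i b => (∑ y, π.1 x y * levelLaw π n y b) * levelStep π n b (c i))]
    refine Finset.prod_congr rfl fun i _ => ?_
    simp_rw [levelLaw, Finset.mul_sum, Finset.sum_mul]
    rw [Finset.sum_comm]
    refine Finset.sum_congr rfl fun y _ => Finset.sum_congr rfl fun b _ => by ring

/-! ### The posterior as a backward martingale -/

lemma exists_eq_comp_frestrictLe {q k n : ℕ} [NeZero q] {f : (Π n, Config q k n) → ℝ}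
    (hf : DependsOn f (Set.Iic n)) :
    ∃ F : (Π i : Finset.Iic n, Config q k i) → ℝ, ∀ ω, f ω = F (Preorder.frestrictLe n ω) := by
  classical
  refine ⟨fun r => f fun m => if h : m ∈ Finset.Iic n then r ⟨m, h⟩ else fun _ => 0,
    fun ω => hf fun m hm => ?_⟩
  rw [dif_pos (Finset.mem_Iic.2 hm)]
  rfl

lemma integrable_of_dependsOn {q k n : ℕ} [NeZero q] (π : Channel q)
    {f : (Π n, Config q k n) → ℝ} (hf : DependsOn f (Set.Iic n)) :
    Integrable f (broadcast k π) := by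
  obtain ⟨F, hF⟩ := exists_eq_comp_frestrictLe hf
  rw [funext hF]
  have hp : IsProbabilityMeasure ((broadcast k π).map
      (Preorder.frestrictLe (π := fun n => Config q k n) n)) :=
    Measure.isProbabilityMeasure_map (by fun_prop)
  exact (Integrable.of_finite (f := F)
    (μ := (broadcast k π).map (Preorder.frestrictLe n))).comp_measurable (by fun_prop)

/-- Integrating out the last generation. -/
lemma integral_dependsOn_succ {q k n : ℕ} [NeZero q] (π : Channel q)
    {f : (Π n, Config q k n) → ℝ} (hf : DependsOn f (Set.Iic (n + 1))) :
    ∫ ω, f ω ∂(broadcast k π)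
      = ∫ ω, ∑ c, levelStep π n (ω n) c * f (Function.update ω (n + 1) c) ∂(broadcast k π) := by
  classical
  have h := integral_broadcast_frestrictLe (k := k) π n fun r c =>
    f (Function.update (fun m => if h : m ∈ Finset.Iic n then r ⟨m, h⟩ else fun _ => 0) (n + 1) c)
  have key : ∀ (ω : Π n, Config q k n) (c : Config q k (n + 1)),
      f (Function.update (fun m => if h : m ∈ Finset.Iic n then Preorder.frestrictLe n ω ⟨m, h⟩
        else fun _ => 0) (n + 1) c) = f (Function.update ω (n + 1) c) := by
    intro ω c
    refine hf fun m hm => ?_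
    by_cases hmn : m = n + 1
    · subst hmn; simp
    · rw [Function.update_of_ne hmn, Function.update_of_ne hmn,
        dif_pos (Finset.mem_Iic.2 (by have := Set.mem_Iic.1 hm; omega))]
      rfl
  simp_rw [key, Function.update_eq_self] at h
  exact h

/-- The probability that the root has colour `y`, given the configuration of generation `ℓ`, as a
random variable. -/
noncomputable def posteriorAt {q k : ℕ} [NeZero q] (π : Channel q) (y : Fin q) (ℓ : ℕ)
    (ω : Π n, Config q k n) : ℝ :=
  (rootPosterior k π ℓ (ω ℓ)).1 y

lemma posteriorAt_dependsOn {q k : ℕ} [NeZero q] (π : Channel q) (y : Fin q) {ℓ : ℕ} {s : Set ℕ}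
    (hs : ℓ ∈ s) : DependsOn (posteriorAt (k := k) π y ℓ) s := by
  intro a b h
  simp only [posteriorAt, h ℓ hs]

lemma integrable_posteriorAt {q k : ℕ} [NeZero q] (π : Channel q) (y : Fin q) (ℓ : ℕ) :
    Integrable (posteriorAt (k := k) π y ℓ) (broadcast k π) :=
  integrable_of_dependsOn π (posteriorAt_dependsOn π y (Set.mem_Iic.2 le_rfl))

/-- The broadcast process is a Markov chain, so the posterior given generation `ℓ` is also the
posterior given all the later generations. -/
lemma integral_root_mul_eq_posteriorAt_mul {q k : ℕ} [NeZero q] (π : Channel q) (y : Fin q)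
    {ℓ M : ℕ} (hM : ℓ ≤ M) {h : (Π n, Config q k n) → ℝ} (hh : DependsOn h (Set.Icc ℓ M)) :
    ∫ ω, (if rootColor ω = y then 1 else 0) * h ω ∂(broadcast k π)
      = ∫ ω, posteriorAt π y ℓ ω * h ω ∂(broadcast k π) := by
  classical
  induction M, hM using Nat.le_induction generalizing h with
  | base =>
    obtain ⟨g, rfl⟩ : ∃ g : Config q k ℓ → ℝ, h = fun ω => g (ω ℓ) := by
      refine ⟨fun c => h (Function.update (fun _ _ => 0) ℓ c), funext fun ω => hh fun m hm => ?_⟩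
      obtain rfl : m = ℓ := le_antisymm hm.2 hm.1
      simp
    refine (integral_root_eq_integral_posterior π ℓ
      (fun x c => (if x = y then 1 else 0) * g c)).trans ?_
    refine integral_congr_ae (.of_forall fun ω => ?_)
    simp [posteriorAt]
  | succ M hM ih =>
    have hd1 : DependsOn
        (fun ω : Π n, Config q k n => (if rootColor ω = y then (1 : ℝ) else 0) * h ω)
        (Set.Iic (M + 1)) := by
      intro a b hab
      have h1 : rootColor a = rootColor b := by
        unfold rootColor
        rw [hab 0 (Set.mem_Iic.2 (by omega))]
      have h2 : h a = h b := hh fun m hm => hab m hm.2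
      simp only [h1, h2]
    have hd2 : DependsOn (fun ω : Π n, Config q k n => posteriorAt π y ℓ ω * h ω)
        (Set.Iic (M + 1)) := by
      intro a b hab
      have h1 := posteriorAt_dependsOn (k := k) π y (ℓ := ℓ) (s := Set.Iic (M + 1))
        (Set.mem_Iic.2 (by omega)) hab
      have h2 : h a = h b := hh fun m hm => hab m hm.2
      simp only [h1, h2]
    have hd3 : DependsOn (fun ω : Π n, Config q k n =>
        ∑ c, levelStep π M (ω M) c * h (Function.update ω (M + 1) c)) (Set.Icc ℓ M) := by
      intro a b hab
      refine Finset.sum_congr rfl fun c _ => ?_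
      rw [hab M ⟨hM, le_rfl⟩]
      congr 1
      refine hh fun m hm => ?_
      by_cases hmn : m = M + 1
      · subst hmn; simp
      · rw [Function.update_of_ne hmn, Function.update_of_ne hmn]
        exact hab m ⟨hm.1, by have := hm.2; omega⟩
    have e := ih hd3
    rw [integral_dependsOn_succ π hd1, integral_dependsOn_succ π hd2]
    convert! e using 2
    · funext ω
      rw [Finset.mul_sum]
      refine Finset.sum_congr rfl fun c _ => ?_
      have h1 : rootColor (Function.update ω (M + 1) c) = rootColor ω := by
        unfold rootColor
        rw [Function.update_of_ne (by omega)]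
      rw [h1]; ring
    · funext ω
      rw [Finset.mul_sum]
      refine Finset.sum_congr rfl fun c _ => ?_
      have h1 : posteriorAt π y ℓ (Function.update ω (M + 1) c) = posteriorAt π y ℓ ω := by
        unfold posteriorAt
        rw [Function.update_of_ne (by omega)]
      rw [h1]; ring

/-- The posteriors at earlier and at later generations have the same integral against a function of
the later generations: seen backwards in time, the posterior is a martingale. -/
lemma integral_posteriorAt_mul {q k : ℕ} [NeZero q] (π : Channel q) (y : Fin q)
    {ℓ N M : ℕ} (hN : ℓ ≤ N) (hM : N ≤ M) {h : (Π n, Config q k n) → ℝ}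
    (hh : DependsOn h (Set.Icc N M)) :
    ∫ ω, posteriorAt π y ℓ ω * h ω ∂(broadcast k π)
      = ∫ ω, posteriorAt π y N ω * h ω ∂(broadcast k π) := by
  rw [← integral_root_mul_eq_posteriorAt_mul π y hM hh,
    ← integral_root_mul_eq_posteriorAt_mul π y (hN.trans hM)
      (fun a b hab => hh fun m hm => hab m ⟨hN.trans hm.1, hm.2⟩)]

/-- The σ-algebra generated by the generations `M - n, …, M`, which grows with `n`: time runs
backwards from generation `M`. For `n ≥ M` it is generated by the generations `0, …, M`. -/
def tailFiltration (q k M : ℕ) :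
    Filtration ℕ (inferInstance : MeasurableSpace (Π n, Config q k n)) where
  seq n := MeasurableSpace.comap (fun ω (i : Finset.Icc (M - n) M) => ω i) inferInstance
  mono' := by
    intro a b hab
    have hsub : ∀ i : Finset.Icc (M - a) M, i.1 ∈ Finset.Icc (M - b) M := fun i => by
      have := Finset.mem_Icc.1 i.2
      exact Finset.mem_Icc.2 ⟨by omega, this.2⟩
    have : (fun (ω : Π n, Config q k n) (i : Finset.Icc (M - a) M) => ω i)
        = (fun r (i : Finset.Icc (M - a) M) => r ⟨i.1, hsub i⟩)
          ∘ (fun ω (i : Finset.Icc (M - b) M) => ω i) := rfl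
    simp only
    rw [this, ← MeasurableSpace.comap_comp]
    exact MeasurableSpace.comap_mono (Measurable.comap_le (by fun_prop))
  le' := fun n => Measurable.comap_le (by fun_prop)

lemma martingale_posteriorAt {q k : ℕ} [NeZero q] (π : Channel q) (y : Fin q) (M : ℕ) :
    Martingale (fun n => posteriorAt (k := k) π y (M - n)) (tailFiltration q k M)
      (broadcast k π) := by
  have hadp : StronglyAdapted (tailFiltration q k M)
      (fun n => posteriorAt (k := k) π y (M - n)) := by
    intro n
    refine Measurable.stronglyMeasurable ?_
    have h1 : Measurable[tailFiltration q k M n]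
        (fun (ω : Π n, Config q k n) (i : Finset.Icc (M - n) M) => ω i) :=
      comap_measurable _
    obtain ⟨g, hc⟩ : ∃ g : (Π i : Finset.Icc (M - n) M, Config q k i) → ℝ,
        posteriorAt (k := k) π y (M - n) = g ∘ fun ω (i : Finset.Icc (M - n) M) => ω i :=
      ⟨fun r => (rootPosterior k π (M - n)
        (r ⟨M - n, Finset.mem_Icc.2 ⟨le_rfl, by omega⟩⟩)).1 y, rfl⟩
    have hg : Measurable g := Measurable.of_discrete
    dsimp only
    rw [hc]
    exact @Measurable.comp _ _ _ (tailFiltration q k M n) _ _ g _ hg h1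
  refine martingale_of_setIntegral_eq_succ hadp (fun n => integrable_posteriorAt π y _) ?_
  intro n s hs
  obtain ⟨S, -, rfl⟩ := hs
  have hs' : MeasurableSet
      ((fun (ω : Π n, Config q k n) (i : Finset.Icc (M - n) M) => ω i) ⁻¹' S) :=
    (tailFiltration q k M).le n _ ⟨S, MeasurableSet.of_discrete, rfl⟩
  set A := (fun (ω : Π n, Config q k n) (i : Finset.Icc (M - n) M) => ω i) ⁻¹' S with hA
  have hd : DependsOn (A.indicator (fun _ => (1 : ℝ))) (Set.Icc (M - n) M) := by
    intro a b hab
    have h1 : (fun i : Finset.Icc (M - n) M => a i) = fun i : Finset.Icc (M - n) M => b i :=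
      funext fun i => hab i.1 (Finset.mem_Icc.1 i.2)
    have h2 : a ∈ A ↔ b ∈ A := iff_of_eq (congrArg (· ∈ S) h1)
    by_cases hb : b ∈ A
    · rw [Set.indicator_of_mem hb, Set.indicator_of_mem (h2.2 hb)]
    · rw [Set.indicator_of_notMem hb, Set.indicator_of_notMem (mt h2.1 hb)]
  have h := integral_posteriorAt_mul π y (ℓ := M - (n + 1)) (by omega) (by omega) hd
  have conv : ∀ f : (Π n, Config q k n) → ℝ, ∫ ω, f ω * A.indicator (fun _ => (1 : ℝ)) ω
      ∂(broadcast k π) = ∫ ω in A, f ω ∂(broadcast k π) := fun f => by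
    rw [← integral_indicator hs']
    refine integral_congr_ae (.of_forall fun ω => ?_)
    by_cases hω : ω ∈ A <;> simp [hω]
  rw [conv, conv] at h
  exact h.symm

/-! ### Almost sure convergence of the posterior -/

/-- A sequence of random variables that satisfies, backwards from every time `M`, a maximal
inequality with bounds that tend to zero is almost surely a Cauchy sequence. -/
lemma ae_cauchySeq_of_backward_maximal {Ω : Type*} {mΩ : MeasurableSpace Ω} (μ : Measure Ω)
    (f : ℕ → Ω → ℝ) (δ : ℕ → ℝ) (hδ : Tendsto δ atTop (𝓝 0))
    (hf : ∀ N M, N ≤ M → ∀ ε : ℝ, 0 < ε →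
      μ {ω | ∃ ℓ, N ≤ ℓ ∧ ℓ ≤ M ∧ ε ≤ |f ℓ ω - f M ω|} ≤ ENNReal.ofReal (δ N / ε)) :
    ∀ᵐ ω ∂μ, CauchySeq fun n => f n ω := by
  have main : ∀ ε : ℝ, 0 < ε → ∀ᵐ ω ∂μ, ∃ N, ∀ ℓ, N ≤ ℓ → |f ℓ ω - f N ω| < 2 * ε := by
    intro ε hε
    let B : ℕ → Set Ω := fun N => {ω | ∃ ℓ, N ≤ ℓ ∧ 2 * ε ≤ |f ℓ ω - f N ω|}
    have hB : ∀ N, μ (B N) ≤ ENNReal.ofReal (δ N / ε) := by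
      intro N
      let C : ℕ → Set Ω := fun M => {ω | ∃ ℓ, N ≤ ℓ ∧ ℓ ≤ N + M ∧ 2 * ε ≤ |f ℓ ω - f N ω|}
      have hBC : B N = ⋃ M, C M := by
        ext ω
        simp only [B, C, Set.mem_ofPred_eq, Set.mem_iUnion]
        constructor
        · rintro ⟨ℓ, h1, h2⟩
          exact ⟨ℓ, ℓ, h1, by omega, h2⟩
        · rintro ⟨M, ℓ, h1, -, h2⟩
          exact ⟨ℓ, h1, h2⟩
      have hmono : Monotone C := by
        rintro a b hab ω ⟨ℓ, h1, h2, h3⟩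
        exact ⟨ℓ, h1, by omega, h3⟩
      rw [hBC, hmono.measure_iUnion]
      refine iSup_le fun M => (measure_mono ?_).trans (hf N (N + M) (by omega) ε hε)
      rintro ω ⟨ℓ, h1, h2, h3⟩
      -- one of `f ℓ`, `f N` is at distance at least `ε` from `f (N + M)`
      by_cases h : ε ≤ |f ℓ ω - f (N + M) ω|
      · exact ⟨ℓ, h1, h2, h⟩
      · refine ⟨N, le_rfl, by omega, ?_⟩
        have := abs_sub_le (f ℓ ω) (f (N + M) ω) (f N ω)
        rw [abs_sub_comm (f (N + M) ω)] at this
        linarith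
    have h0 : μ (⋂ N, B N) = 0 := by
      have ht : Tendsto (fun N => ENNReal.ofReal (δ N / ε)) atTop (𝓝 0) := by
        have := ENNReal.tendsto_ofReal (hδ.div_const ε)
        simpa using this
      exact le_antisymm (ge_of_tendsto' ht fun N =>
        (measure_mono (Set.iInter_subset _ N)).trans (hB N)) zero_le
    rw [ae_iff]
    convert h0 using 2
    ext ω
    simp [B]
  have all : ∀ᵐ ω ∂μ, ∀ n : ℕ, ∃ N, ∀ ℓ, N ≤ ℓ → |f ℓ ω - f N ω| < 2 * (1 / ((n : ℝ) + 1)) :=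
    ae_all_iff.2 fun n => main _ (by positivity)
  filter_upwards [all] with ω hω
  rw [Metric.cauchySeq_iff']
  intro ε hε
  obtain ⟨n, hn⟩ := exists_nat_one_div_lt (half_pos hε)
  obtain ⟨N, hN⟩ := hω n
  exact ⟨N, fun ℓ hℓ => by rw [Real.dist_eq]; linarith [hN ℓ hℓ]⟩

lemma integral_sub_const_mul_add {Ω : Type*} {mΩ : MeasurableSpace Ω} {μ : Measure Ω}
    {f g h : Ω → ℝ} (hf : Integrable f μ) (hg : Integrable g μ) (hh : Integrable h μ) (c : ℝ) :
    ∫ ω, (f ω - c * g ω + h ω) ∂μ = ∫ ω, f ω ∂μ - c * ∫ ω, g ω ∂μ + ∫ ω, h ω ∂μ := by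
  have h1 : ∫ ω, (f ω - c * g ω + h ω) ∂μ = ∫ ω, (f ω - c * g ω) ∂μ + ∫ ω, h ω ∂μ :=
    integral_add (hf.sub (hg.const_mul c)) hh
  rw [h1, integral_sub hf (hg.const_mul c), integral_const_mul]

/-- The second moments of the posterior probabilities. -/
noncomputable def posteriorSq {q : ℕ} [NeZero q] (k : ℕ) (π : Channel q) (y : Fin q) (ℓ : ℕ) : ℝ :=
  ∫ ω, posteriorAt π y ℓ ω ^ 2 ∂(broadcast k π)

/-- Orthogonality of martingale increments. -/
lemma integral_posteriorAt_sub_sq {q k : ℕ} [NeZero q] (π : Channel q) (y : Fin q) {N M : ℕ}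
    (h : N ≤ M) :
    ∫ ω, (posteriorAt π y N ω - posteriorAt π y M ω) ^ 2 ∂(broadcast k π)
      = posteriorSq k π y N - posteriorSq k π y M := by
  have h1 := integral_posteriorAt_mul (k := k) π y h le_rfl
    (posteriorAt_dependsOn π y (s := Set.Icc M M) ⟨le_rfl, le_rfl⟩)
  have hd : ∀ a b, a ≤ M → b ≤ M → Integrable
      (fun ω : Π n, Config q k n => posteriorAt π y a ω * posteriorAt π y b ω) (broadcast k π) := by
    intro a b ha hb
    refine integrable_of_dependsOn π (n := M) fun u v huv => ?_
    rw [posteriorAt_dependsOn π y (Set.mem_Iic.2 ha) huv,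
      posteriorAt_dependsOn π y (Set.mem_Iic.2 hb) huv]
  have e : ∀ ω : Π n, Config q k n, (posteriorAt π y N ω - posteriorAt π y M ω) ^ 2
      = posteriorAt π y N ω * posteriorAt π y N ω
        - 2 * (posteriorAt π y N ω * posteriorAt π y M ω)
        + posteriorAt π y M ω * posteriorAt π y M ω := fun ω => by ring
  simp_rw [e, posteriorSq, pow_two]
  rw [integral_sub_const_mul_add (hd N N h h) (hd N M h le_rfl) (hd M M le_rfl le_rfl), h1]
  ring

lemma integral_abs_posteriorAt_sub_le {q k : ℕ} [NeZero q] (π : Channel q) (y : Fin q) {N M : ℕ}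
    (h : N ≤ M) :
    ∫ ω, |posteriorAt π y N ω - posteriorAt π y M ω| ∂(broadcast k π)
      ≤ √(posteriorSq k π y N - posteriorSq k π y M) := by
  apply Real.le_sqrt_of_sq_le
  rw [← integral_posteriorAt_sub_sq π y h]
  have hd : DependsOn (fun ω : Π n, Config q k n => posteriorAt π y N ω - posteriorAt π y M ω)
      (Set.Iic M) := fun u v huv => by
    dsimp only
    rw [posteriorAt_dependsOn π y (Set.mem_Iic.2 h) huv,
      posteriorAt_dependsOn π y (Set.mem_Iic.2 le_rfl) huv]
  have i1 : Integrable (fun ω : Π n, Config q k n =>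
      |posteriorAt π y N ω - posteriorAt π y M ω|) (broadcast k π) :=
    integrable_of_dependsOn π fun u v huv => congrArg _ (hd huv)
  have i2 : Integrable (fun ω : Π n, Config q k n =>
      (posteriorAt π y N ω - posteriorAt π y M ω) ^ 2) (broadcast k π) :=
    integrable_of_dependsOn π fun u v huv => congrArg (fun t : ℝ => t ^ 2) (hd huv)
  set a := ∫ ω, |posteriorAt π y N ω - posteriorAt π y M ω| ∂(broadcast k π)
  -- the variance of `|posteriorAt N - posteriorAt M|` is nonnegative
  have h0 : 0 ≤ ∫ ω : Π n, Config q k n, ((posteriorAt π y N ω - posteriorAt π y M ω) ^ 2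
      - 2 * a * |posteriorAt π y N ω - posteriorAt π y M ω| + a ^ 2) ∂(broadcast k π) := by
    refine integral_nonneg fun ω => ?_
    have := sq_nonneg (|posteriorAt π y N ω - posteriorAt π y M ω| - a)
    rw [sub_sq, sq_abs] at this
    simp only [Pi.zero_apply]
    linarith
  rw [integral_sub_const_mul_add i2 i1 (integrable_const _), integral_const] at h0
  simp only [probReal_univ, smul_eq_mul, one_mul] at h0
  nlinarith

lemma posteriorSq_antitone {q : ℕ} [NeZero q] (k : ℕ) (π : Channel q) (y : Fin q) :
    Antitone (posteriorSq k π y) := fun N M h => by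
  have := integral_posteriorAt_sub_sq (k := k) π y h
  have h0 : 0 ≤ ∫ ω, (posteriorAt π y N ω - posteriorAt π y M ω) ^ 2 ∂(broadcast k π) :=
    integral_nonneg fun ω => sq_nonneg _
  linarith

/-- Doob's inequality for the posterior, run backwards from generation `M`. -/
lemma posteriorAt_backward_maximal {q k : ℕ} [NeZero q] (π : Channel q) (y : Fin q) {N M : ℕ}
    (h : N ≤ M) {ε : ℝ} (hε : 0 < ε) :
    (broadcast k π) {ω | ∃ ℓ, N ≤ ℓ ∧ ℓ ≤ M ∧ ε ≤ |posteriorAt π y ℓ ω - posteriorAt π y M ω|}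
      ≤ ENNReal.ofReal
        ((∫ ω, |posteriorAt π y N ω - posteriorAt π y M ω| ∂(broadcast k π)) / ε) := by
  have hmart := martingale_posteriorAt (k := k) π y M
  have hconst : Martingale (fun _ : ℕ => posteriorAt (k := k) π y M) (tailFiltration q k M)
      (broadcast k π) := by
    refine martingale_of_setIntegral_eq_succ (fun n => ?_) (fun n => integrable_posteriorAt π y _)
      fun _ _ _ => rfl
    have := (hmart.stronglyAdapted 0).mono ((tailFiltration q k M).mono (Nat.zero_le n))
    simpa using this
  -- the absolute value of a martingale `d` is the submartingale `d ⊔ -d`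
  have hd := hmart.sub hconst
  have hsub := hd.submartingale.sup hd.neg.submartingale
  set g : ℕ → (Π n, Config q k n) → ℝ :=
    fun n ω => |posteriorAt π y (M - n) ω - posteriorAt π y M ω| with hg
  have hsub' : Submartingale g (tailFiltration q k M) (broadcast k π) := hsub
  have hmax := maximal_ineq hsub' (fun n ω => abs_nonneg _) (ε := ε.toNNReal) (M - N)
  rw [Real.coe_toNNReal _ hε.le] at hmax
  have hsubset : {ω : Π n, Config q k n |
      ∃ ℓ, N ≤ ℓ ∧ ℓ ≤ M ∧ ε ≤ |posteriorAt π y ℓ ω - posteriorAt π y M ω|}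
      ⊆ {ω | ε ≤ (Finset.range (M - N + 1)).sup' Finset.nonempty_range_add_one
        fun n => g n ω} := by
    rintro ω ⟨ℓ, h1, h2, h3⟩
    refine h3.trans ?_
    have : g (M - ℓ) ω ≤ _ := Finset.le_sup' (fun n => g n ω)
      (Finset.mem_range.2 (by omega : M - ℓ < M - N + 1))
    simp only [hg, show M - (M - ℓ) = ℓ by omega] at this
    exact this
  have hle : ∫ ω in {ω | ε ≤ (Finset.range (M - N + 1)).sup' Finset.nonempty_range_add_one
        fun n => g n ω}, g (M - N) ω ∂(broadcast k π) ≤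
      ∫ ω, |posteriorAt π y N ω - posteriorAt π y M ω| ∂(broadcast k π) := by
    have e : (fun ω : Π n, Config q k n => |posteriorAt π y N ω - posteriorAt π y M ω|)
      = g (M - N) := by simp only [hg, show M - (M - N) = N by omega]
    rw [e]
    exact setIntegral_le_integral (hsub'.integrable _) (.of_forall fun ω => abs_nonneg _)
  rw [ENNReal.ofReal_div_of_pos hε, ENNReal.le_div_iff_mul_le (by simp [hε]) (by simp), mul_comm]
  refine le_trans ?_ (hmax.trans (ENNReal.ofReal_le_ofReal hle))
  exact mul_le_mul_right (measure_mono hsubset) _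

/-- The second moments decrease with the generation, hence converge, so the posteriors are Cauchy in
`L²`; the maximal inequality turns this into almost sure convergence. -/
lemma ae_cauchySeq_posteriorAt {q k : ℕ} [NeZero q] (π : Channel q) (y : Fin q) :
    ∀ᵐ ω ∂(broadcast k π), CauchySeq fun ℓ => posteriorAt π y ℓ ω := by
  have hb : BddBelow (Set.range (posteriorSq k π y)) :=
    ⟨0, by rintro _ ⟨n, rfl⟩; exact integral_nonneg fun ω => sq_nonneg _⟩
  have ht := tendsto_atTop_ciInf (posteriorSq_antitone k π y) hb
  refine ae_cauchySeq_of_backward_maximal _ _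
    (fun N => √(posteriorSq k π y N - ⨅ M, posteriorSq k π y M)) ?_ ?_
  · have := (ht.sub_const (⨅ M, posteriorSq k π y M)).sqrt
    simpa using this
  · intro N M h ε hε
    refine (posteriorAt_backward_maximal π y h hε).trans (ENNReal.ofReal_le_ofReal ?_)
    refine div_le_div_of_nonneg_right ((integral_abs_posteriorAt_sub_le π y h).trans ?_) hε.le
    exact Real.sqrt_le_sqrt (sub_le_sub_left (ciInf_le hb M) _)

/-- The posterior of the root converges almost surely. -/
lemma exists_posterior_limit {q : ℕ} [NeZero q] (k : ℕ) (π : Channel q) :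
    ∃ ηlim : (Π n, Config q k n) → Simplex q, Measurable ηlim ∧
      ∀ᵐ ω ∂(broadcast k π),
        Tendsto (fun ℓ => rootPosterior k π ℓ (ω ℓ)) atTop (𝓝 (ηlim ω)) := by
  have hc : ∀ᵐ ω ∂(broadcast k π),
      ∃ l, Tendsto (fun ℓ => rootPosterior k π ℓ (ω ℓ)) atTop (𝓝 l) := by
    have hall : ∀ᵐ ω ∂(broadcast k π), ∀ y, CauchySeq fun ℓ => posteriorAt π y ℓ ω :=
      ae_all_iff.2 fun y => ae_cauchySeq_posteriorAt π y
    filter_upwards [hall] with ω hω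
    choose l hl using fun y => cauchySeq_tendsto_of_complete (hω y)
    have ht : Tendsto (fun ℓ => (rootPosterior k π ℓ (ω ℓ)).1) atTop (𝓝 l) :=
      tendsto_pi_nhds.2 hl
    have hmem : l ∈ stdSimplex ℝ (Fin q) :=
      (isClosed_stdSimplex ℝ (Fin q)).mem_of_tendsto ht (.of_forall fun ℓ => Subtype.mem _)
    exact ⟨⟨l, hmem⟩, tendsto_subtype_rng.2 ht⟩
  obtain ⟨ηlim, h1, h2⟩ := measurable_limit_of_tendsto_metrizable_ae
    (fun ℓ => (measurable_rootPosterior π ℓ).aemeasurable) hc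
  exact ⟨ηlim, h1, h2⟩

/-! ### The merging map -/

lemma mergeZ_mul_merge {q k : ℕ} [NeZero q] (π : Channel q) (η : Fin k → Simplex q) (y : Fin q) :
    mergeZ π η * (merge π η).1 y = mergeWeight π η y := by
  by_cases h : mergeZ π η = 0
  · rw [h, zero_mul]
    exact ((Finset.sum_eq_zero_iff_of_nonneg fun y _ => mergeWeight_nonneg π η y).1 h y
      (Finset.mem_univ y)).symm
  · rw [merge, dif_neg h]
    field_simp

lemma mergeZ_nonneg {q k : ℕ} (π : Channel q) (η : Fin k → Simplex q) : 0 ≤ mergeZ π η :=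
  Finset.sum_nonneg fun y _ => mergeWeight_nonneg π η y

lemma continuous_simplex_apply {q : ℕ} (y : Fin q) : Continuous fun η : Simplex q => η.1 y :=
  (continuous_apply y).comp continuous_subtype_val

lemma continuous_mergeWeight {q k : ℕ} (π : Channel q) (y : Fin q) :
    Continuous fun η : Fin k → Simplex q => mergeWeight π η y :=
  continuous_finsetProd _ fun i _ => continuous_finsetSum _ fun y' _ =>
    continuous_const.mul ((continuous_simplex_apply y').comp (continuous_apply i))

lemma continuous_mergeZ {q k : ℕ} (π : Channel q) :
    Continuous fun η : Fin k → Simplex q => mergeZ π η :=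
  continuous_finsetSum _ fun y _ => continuous_mergeWeight π y

lemma measurable_merge {q k : ℕ} [NeZero q] (π : Channel q) :
    Measurable (merge π : (Fin k → Simplex q) → Simplex q) := by
  have h : (fun η : Fin k → Simplex q => (merge π η).1)
      = fun η => if mergeZ π η = 0 then (unif q).1
        else fun y => mergeWeight π η y / mergeZ π η := by
    funext η
    by_cases h : mergeZ π η = 0
    · rw [merge, dif_pos h, if_pos h]
    · rw [merge, dif_neg h, if_neg h]
  have hm : Measurable fun η : Fin k → Simplex q => (merge π η).1 := by
    rw [h]
    refine Measurable.ite ?_ measurable_const ?_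
    · exact (continuous_mergeZ π).measurable (measurableSet_singleton 0)
    · exact measurable_pi_lambda _ fun y =>
        (continuous_mergeWeight π y).measurable.div (continuous_mergeZ π).measurable
  exact hm.subtype_mk (h := fun η => (merge π η).2)

/-- Although `merge` is discontinuous where `mergeZ` vanishes, the factor `mergeZ` removes the
discontinuity. -/
lemma continuous_mergeZ_mul_comp_merge {q k : ℕ} [NeZero q] (π : Channel q)
    (g : BoundedContinuousFunction (Simplex q) ℝ) :
    Continuous fun η : Fin k → Simplex q => mergeZ π η * g (merge π η) := by
  rw [continuous_iff_continuousAt]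
  intro η₀
  by_cases h : mergeZ π η₀ = 0
  · rw [ContinuousAt, h, zero_mul]
    have hz : Tendsto (fun η : Fin k → Simplex q => mergeZ π η * ‖g‖) (𝓝 η₀) (𝓝 0) := by
      have := ((continuous_mergeZ π).tendsto η₀).mul_const ‖g‖
      rwa [h, zero_mul] at this
    refine squeeze_zero_norm (fun η => ?_) hz
    rw [norm_mul, Real.norm_of_nonneg (mergeZ_nonneg π η)]
    exact mul_le_mul_of_nonneg_left (g.norm_coe_le_norm _) (mergeZ_nonneg π η)
  · refine (continuous_mergeZ π).continuousAt.mul (g.continuous.continuousAt.comp ?_)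
    rw [ContinuousAt, tendsto_subtype_rng]
    have hne : ∀ᶠ η in 𝓝 η₀, mergeZ π η ≠ 0 := (continuous_mergeZ π).continuousAt.eventually_ne h
    have ht : Tendsto (fun (η : Fin k → Simplex q) y => mergeWeight π η y / mergeZ π η) (𝓝 η₀)
        (𝓝 fun y => mergeWeight π η₀ y / mergeZ π η₀) :=
      tendsto_pi_nhds.2 fun y => ((continuous_mergeWeight π y).tendsto η₀).div
        ((continuous_mergeZ π).tendsto η₀) h
    have e : (merge π η₀).1 = fun y => mergeWeight π η₀ y / mergeZ π η₀ := by
      rw [merge, dif_neg h]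
    rw [e]
    refine ht.congr' (hne.mono fun η hη => ?_)
    dsimp only
    rw [merge, dif_neg hη]

/-- The measure on the right-hand side of the fixed-point equation. -/
noncomputable def recursionMap {q : ℕ} [NeZero q] (k : ℕ) (π : Channel q)
    (Q : Measure (Simplex q)) : Measure (Simplex q) :=
  ((Measure.pi fun _ : Fin k => Q).withDensity
    fun η => ENNReal.ofReal ((q : ℝ) ^ (k - 1) * mergeZ π η)).map (merge π)

lemma measurable_density {q k : ℕ} (π : Channel q) : Measurable fun η : Fin k → Simplex q =>
    ENNReal.ofReal ((q : ℝ) ^ (k - 1) * mergeZ π η) :=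
  ((continuous_mergeZ π).measurable.const_mul _).ennreal_ofReal

lemma integral_recursionMap {q : ℕ} [NeZero q] (k : ℕ) (π : Channel q) (Q : Measure (Simplex q))
    {g : Simplex q → ℝ} (hg : Measurable g) :
    ∫ η, g η ∂(recursionMap k π Q)
      = ∫ η, (q : ℝ) ^ (k - 1) * (mergeZ π η * g (merge π η)) ∂(Measure.pi fun _ : Fin k => Q) := by
  rw [recursionMap, integral_map (measurable_merge π).aemeasurable hg.aestronglyMeasurable,
    integral_withDensity_eq_integral_toReal_smul (measurable_density π)
      (.of_forall fun _ => ENNReal.ofReal_lt_top)]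
  refine integral_congr_ae (.of_forall fun η => ?_)
  dsimp only
  rw [ENNReal.toReal_ofReal (mul_nonneg (by positivity) (mergeZ_nonneg π η)), smul_eq_mul,
    mul_assoc]

lemma lintegral_recursionMap {q : ℕ} [NeZero q] (k : ℕ) (π : Channel q) (Q : Measure (Simplex q))
    {g : Simplex q → ENNReal} (hg : Measurable g) :
    ∫⁻ η, g η ∂(recursionMap k π Q)
      = ∫⁻ η, ENNReal.ofReal ((q : ℝ) ^ (k - 1) * mergeZ π η) * g (merge π η)
        ∂(Measure.pi fun _ : Fin k => Q) := by
  rw [recursionMap, lintegral_map hg (measurable_merge π)]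
  exact lintegral_withDensity_eq_lintegral_mul _ (measurable_density π)
    (hg.comp (measurable_merge π))

lemma mergeZ_bounded {q k : ℕ} (π : Channel q) :
    ∃ C : ℝ, ∀ η : Fin k → Simplex q, mergeZ π η ≤ C := by
  obtain ⟨C, hC⟩ := isCompact_univ.bddAbove_image (continuous_mergeZ (k := k) π).continuousOn
  exact ⟨C, fun η => hC ⟨η, Set.mem_univ η, rfl⟩⟩

instance {q : ℕ} [NeZero q] (k : ℕ) (π : Channel q) (Q : Measure (Simplex q))
    [IsProbabilityMeasure Q] : IsFiniteMeasure (recursionMap k π Q) := by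
  obtain ⟨C, hC⟩ := mergeZ_bounded (k := k) π
  refine ⟨?_⟩
  rw [← lintegral_one, lintegral_recursionMap k π Q measurable_const]
  refine lt_of_le_of_lt (lintegral_mono (g := fun _ => ENNReal.ofReal ((q : ℝ) ^ (k - 1) * C))
    fun η => ?_) ?_
  · dsimp only
    rw [mul_one]
    exact ENNReal.ofReal_le_ofReal (mul_le_mul_of_nonneg_left (hC η) (by positivity))
  · rw [lintegral_const, measure_univ, mul_one]
    exact ENNReal.ofReal_lt_top

/-! ### The recursion for the law of the posterior -/

lemma levelLaw_eq_mul_rootPosterior {q k : ℕ} [NeZero q] (π : Channel q) (ℓ : ℕ)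
    (c : Config q k ℓ) (x : Fin q) :
    levelLaw π ℓ x c = q * (levelProb π ℓ c * (rootPosterior k π ℓ c).1 x) := by
  have hq : (q : ℝ) ≠ 0 := by simp [NeZero.ne q]
  rw [levelProb_mul_rootPosterior]
  field_simp

lemma levelLaw_succ_eq_mergeWeight {q k : ℕ} [NeZero q] (π : Channel q) (ℓ : ℕ)
    (c : Fin k → Config q k ℓ) (x : Fin q) :
    levelLaw π (ℓ + 1) x (configSplit q k ℓ c) = (q : ℝ) ^ k *
      ((∏ i, levelProb π ℓ (c i)) * mergeWeight π (fun i => rootPosterior k π ℓ (c i)) x) := by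
  rw [levelLaw_succ_configSplit, mergeWeight, ← Finset.prod_mul_distrib]
  have : (q : ℝ) ^ k = ∏ _i : Fin k, (q : ℝ) := by simp
  rw [this, ← Finset.prod_mul_distrib]
  refine Finset.prod_congr rfl fun i _ => ?_
  simp_rw [levelLaw_eq_mul_rootPosterior, Finset.mul_sum]
  refine Finset.sum_congr rfl fun y _ => by ring

lemma levelProb_succ {q k : ℕ} [NeZero q] (hk : 1 ≤ k) (π : Channel q) (ℓ : ℕ)
    (c : Fin k → Config q k ℓ) :
    levelProb π (ℓ + 1) (configSplit q k ℓ c) = (∏ i, levelProb π ℓ (c i)) *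
      ((q : ℝ) ^ (k - 1) * mergeZ π (fun i => rootPosterior k π ℓ (c i))) := by
  have hq : (q : ℝ) ≠ 0 := by simp [NeZero.ne q]
  have hqk : (q : ℝ) ^ k = q * q ^ (k - 1) := by
    rw [← pow_succ']; congr 1; omega
  rw [levelProb, mergeZ]
  simp_rw [levelLaw_succ_eq_mergeWeight, Finset.mul_sum, hqk]
  refine Finset.sum_congr rfl fun y _ => ?_
  field_simp

/-- The posterior of the root is obtained by merging the posteriors of its children. -/
lemma rootPosterior_succ {q k : ℕ} [NeZero q] (hk : 1 ≤ k) (π : Channel q) (ℓ : ℕ)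
    (c : Fin k → Config q k ℓ) (h : levelProb π (ℓ + 1) (configSplit q k ℓ c) ≠ 0) :
    rootPosterior k π (ℓ + 1) (configSplit q k ℓ c)
      = merge π (fun i => rootPosterior k π ℓ (c i)) := by
  have hq : (q : ℝ) ≠ 0 := by simp [NeZero.ne q]
  have hqk : (q : ℝ) ^ k = q * q ^ (k - 1) := by
    rw [← pow_succ']; congr 1; omega
  refine Subtype.ext (funext fun x => mul_left_cancel₀ h ?_)
  rw [levelProb_mul_rootPosterior, levelLaw_succ_eq_mergeWeight, ← mergeZ_mul_merge,
    levelProb_succ hk, hqk]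
  field_simp

lemma integral_pi_level {q k : ℕ} [NeZero q] (π : Channel q) (ℓ : ℕ)
    (G : (Fin k → Config q k ℓ) → ℝ) :
    ∫ ω, G (fun i => ω i ℓ) ∂(Measure.pi fun _ : Fin k => broadcast k π)
      = ∑ c, (∏ i, levelProb π ℓ (c i)) * G c := by
  have hp : IsProbabilityMeasure ((broadcast k π).map fun ω => ω ℓ) :=
    Measure.isProbabilityMeasure_map (measurable_pi_apply ℓ).aemeasurable
  have h := Measure.pi_map_pi (μ := fun _ : Fin k => broadcast k π)
    (f := fun (_ : Fin k) (ω : Π n, Config q k n) => ω ℓ)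
    (fun _ => (measurable_pi_apply ℓ).aemeasurable)
  have hm : Measurable fun (ω : Fin k → Π n, Config q k n) (i : Fin k) => ω i ℓ := by fun_prop
  rw [← integral_map (f := G) hm.aemeasurable Measurable.of_discrete.aestronglyMeasurable, h,
    integral_fintype Integrable.of_finite]
  refine Finset.sum_congr rfl fun c _ => ?_
  rw [measureReal_def, Measure.pi_singleton, ENNReal.toReal_prod, smul_eq_mul]
  congr 1
  refine Finset.prod_congr rfl fun i _ => ?_
  rw [Measure.map_apply (measurable_pi_apply ℓ) (measurableSet_singleton _), ← real_level]
  rfl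

/-- The law of the posterior at generation `ℓ + 1` is the image under the recursion of the law of
the posterior at generation `ℓ`. -/
lemma integral_rootPosterior_succ {q k : ℕ} [NeZero q] (hk : 1 ≤ k) (π : Channel q) (ℓ : ℕ)
    (g : Simplex q → ℝ) :
    ∫ ω, g (rootPosterior k π (ℓ + 1) (ω (ℓ + 1))) ∂(broadcast k π)
      = ∫ ω, (q : ℝ) ^ (k - 1) * (mergeZ π (fun i => rootPosterior k π ℓ (ω i ℓ)) *
          g (merge π fun i => rootPosterior k π ℓ (ω i ℓ)))
        ∂(Measure.pi fun _ : Fin k => broadcast k π) := by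
  rw [integral_level π (ℓ + 1) (fun c => g (rootPosterior k π (ℓ + 1) c)),
    integral_pi_level π ℓ (fun c => (q : ℝ) ^ (k - 1) *
      (mergeZ π (fun i => rootPosterior k π ℓ (c i)) *
        g (merge π fun i => rootPosterior k π ℓ (c i)))), ← (configSplit q k ℓ).sum_comp]
  refine Finset.sum_congr rfl fun c _ => ?_
  by_cases h : levelProb π (ℓ + 1) (configSplit q k ℓ c) = 0
  · -- such configurations carry no weight on either side, whatever the conventional posterior
    have h' := h
    rw [levelProb_succ hk] at h'
    rw [h, zero_mul, ← mul_assoc ((q : ℝ) ^ (k - 1)), ← mul_assoc, h', zero_mul]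
  · rw [rootPosterior_succ hk π ℓ c h, levelProb_succ hk]
    ring

/-- The law of the limiting posterior solves the fixed-point equation: the recursion is tested
against a bounded continuous function and passes to the limit on `k` independent copies of the
broadcast process. -/
lemma isFixedPoint_map_limit {q k : ℕ} [NeZero q] (hk : 1 ≤ k) (π : Channel q)
    {ηlim : (Π n, Config q k n) → Simplex q} (hm : Measurable ηlim)
    (hlim : ∀ᵐ ω ∂(broadcast k π),
      Tendsto (fun ℓ => rootPosterior k π ℓ (ω ℓ)) atTop (𝓝 (ηlim ω))) :
    IsFixedPoint k π ((broadcast k π).map ηlim) := by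
  have hp : IsProbabilityMeasure ((broadcast k π).map ηlim) :=
    Measure.isProbabilityMeasure_map hm.aemeasurable
  change _ = recursionMap k π _
  refine ext_of_forall_integral_eq_of_IsFiniteMeasure fun g => ?_
  rw [integral_recursionMap k π _ g.continuous.measurable,
    integral_map hm.aemeasurable g.continuous.measurable.aestronglyMeasurable]
  have hg := continuous_mergeZ_mul_comp_merge (k := k) π g
  have hmk : Measurable fun (ω : Fin k → Π n, Config q k n) (i : Fin k) => ηlim (ω i) := by
    fun_prop
  rw [← Measure.pi_map_pi (fun _ => hm.aemeasurable), integral_map hmk.aemeasurable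
    (hg.measurable.const_mul _).aestronglyMeasurable]
  -- both sides are limits of the two sides of the finite-generation recursion
  have t1 : Tendsto (fun ℓ => ∫ ω, g (rootPosterior k π (ℓ + 1) (ω (ℓ + 1))) ∂(broadcast k π))
      atTop (𝓝 (∫ ω, g (ηlim ω) ∂(broadcast k π))) := by
    refine tendsto_integral_of_dominated_convergence (fun _ => ‖g‖)
      (fun ℓ => (g.continuous.measurable.comp
        (measurable_rootPosterior π (ℓ + 1))).aestronglyMeasurable)
      (integrable_const _) (fun ℓ => .of_forall fun ω => g.norm_coe_le_norm _) ?_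
    filter_upwards [hlim] with ω hω
    exact (g.continuous.tendsto _).comp (hω.comp (tendsto_add_atTop_nat 1))
  obtain ⟨C, hC⟩ := mergeZ_bounded (k := k) π
  have hall : ∀ᵐ ω ∂(Measure.pi fun _ : Fin k => broadcast k π), ∀ i,
      Tendsto (fun ℓ => rootPosterior k π ℓ (ω i ℓ)) atTop (𝓝 (ηlim (ω i))) :=
    ae_all_iff.2 fun i =>
      (measurePreserving_eval (fun _ : Fin k => broadcast k π) i).quasiMeasurePreserving.ae hlim
  have t2 : Tendsto (fun ℓ => ∫ ω, (q : ℝ) ^ (k - 1) *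
      (mergeZ π (fun i => rootPosterior k π ℓ (ω i ℓ)) *
          g (merge π fun i => rootPosterior k π ℓ (ω i ℓ)))
        ∂(Measure.pi fun _ : Fin k => broadcast k π)) atTop
      (𝓝 (∫ ω, (q : ℝ) ^ (k - 1) * (mergeZ π (fun i => ηlim (ω i)) *
          g (merge π fun i => ηlim (ω i))) ∂(Measure.pi fun _ : Fin k => broadcast k π))) := by
    refine tendsto_integral_of_dominated_convergence (fun _ => (q : ℝ) ^ (k - 1) * (C * ‖g‖))
      (fun ℓ => ?_) (integrable_const _) (fun ℓ => .of_forall fun ω => ?_) ?_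
    · have h1 : Measurable fun (ω : Fin k → Π n, Config q k n) (i : Fin k) =>
          rootPosterior k π ℓ (ω i ℓ) :=
        measurable_pi_lambda _ fun i => (measurable_rootPosterior π ℓ).comp (measurable_pi_apply i)
      exact ((hg.measurable.const_mul _).comp h1).aestronglyMeasurable
    · rw [norm_mul, norm_mul, Real.norm_of_nonneg (by positivity),
        Real.norm_of_nonneg (mergeZ_nonneg π _)]
      refine mul_le_mul_of_nonneg_left ?_ (by positivity)
      exact mul_le_mul (hC _) (g.norm_coe_le_norm _) (norm_nonneg _)
        ((mergeZ_nonneg π fun i => ηlim (ω i)).trans (hC _))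
    · filter_upwards [hall] with ω hω
      exact ((hg.tendsto _).comp (tendsto_pi_nhds.2 hω)).const_mul _
  refine tendsto_nhds_unique t1 (t2.congr fun ℓ => ?_)
  exact (integral_rootPosterior_succ hk π ℓ g).symm

/-! ### The mean of a fixed point -/

lemma simplex_apply_le_one {q : ℕ} (η : Simplex q) (x : Fin q) : η.1 x ≤ 1 := by
  rw [← η.2.2]
  exact Finset.single_le_sum (fun y _ => η.2.1 y) (Finset.mem_univ x)

lemma integrable_simplex_apply {q : ℕ} (Q : Measure (Simplex q)) [IsFiniteMeasure Q] (x : Fin q) :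
    Integrable (fun η : Simplex q => η.1 x) Q := by
  refine Integrable.of_bound (continuous_simplex_apply x).measurable.aestronglyMeasurable 1
    (.of_forall fun η => ?_)
  rw [Real.norm_of_nonneg (η.2.1 x)]
  exact simplex_apply_le_one η x

/-- Integrating `η ↦ η x` in the fixed-point equation gives a closed equation for the mean. -/
lemma fixedPoint_mean_eq {q k : ℕ} [NeZero q] (π : Channel q) {Q : Measure (Simplex q)}
    [IsProbabilityMeasure Q] (hQ : IsFixedPoint k π Q) (x : Fin q) :
    ∫ η, η.1 x ∂Q = (q : ℝ) ^ (k - 1) * (∑ y, π.1 x y * ∫ η, η.1 y ∂Q) ^ k := by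
  have h : ∫ η, η.1 x ∂Q = ∫ η, η.1 x ∂(recursionMap k π Q) := 
    congrArg (fun ν : Measure (Simplex q) => ∫ η : Simplex q, η.1 x ∂ν) hQ
  rw [h, integral_recursionMap k π Q (continuous_simplex_apply x).measurable]
  simp_rw [mergeZ_mul_merge, mergeWeight]
  rw [integral_const_mul, integral_fintype_prod_eq_prod
    (f := fun (_ : Fin k) (η : Simplex q) => ∑ y, π.1 x y * η.1 y)]
  simp only [Finset.prod_const, Finset.card_univ, Fintype.card_fin]
  rw [integral_finsetSum _ fun y _ => (integrable_simplex_apply Q y).const_mul _]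
  simp_rw [integral_const_mul]

/-- Bernoulli's inequality with a quadratic remainder, which makes the equality case visible. -/
lemma one_add_mul_add_sq_le_pow {t : ℝ} (ht : 0 ≤ t) {k : ℕ} (hk : 2 ≤ k) :
    1 + k * (t - 1) + (t - 1) ^ 2 ≤ t ^ k := by
  induction k, hk using Nat.le_induction with
  | base => push_cast; nlinarith
  | succ k hk ih =>
    have h1 : t * (1 + k * (t - 1) + (t - 1) ^ 2) ≤ t * t ^ k := mul_le_mul_of_nonneg_left ih ht
    have hk' : (2 : ℝ) ≤ k := by exact_mod_cast hk
    rw [pow_succ' t k]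
    push_cast
    nlinarith [mul_nonneg ht (sq_nonneg (t - 1)),
      mul_nonneg (by linarith : (0 : ℝ) ≤ k - 2) (sq_nonneg (t - 1)), sq_nonneg (t - 1)]

/-- A function that is harmonic for an irreducible channel is constant: a power of the channel
links a maximum to any other letter. -/
lemma harmonic_eq_of_irreducible {q : ℕ} [NeZero q] (π : Channel q) (hirr : π.1.IsIrreducible)
    {h : Fin q → ℝ} (hh : ∀ x, ∑ y, π.1 x y * h y = h x) (x y : Fin q) : h x = h y := by
  have hpow : ∀ (n : ℕ) (x : Fin q), ∑ y, (π ^ n).1 x y * h y = h x := by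
    intro n
    induction n with
    | zero => intro x; simp [Matrix.one_apply]
    | succ n ih =>
      intro x
      rw [pow_succ]
      simp only [Submonoid.coe_mul, Matrix.mul_apply, Finset.sum_mul]
      rw [Finset.sum_comm, ← ih x]
      refine Finset.sum_congr rfl fun z _ => ?_
      rw [← hh z, Finset.mul_sum]
      refine Finset.sum_congr rfl fun w _ => by ring
  obtain ⟨m, -, hm⟩ := Finset.exists_max_image Finset.univ h Finset.univ_nonempty
  have key : ∀ y, h y = h m := by
    intro y
    obtain ⟨n, -, hn⟩ := (Matrix.isIrreducible_iff_exists_pow_pos π.2.1).1 hirr m y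
    have hn' : 0 < (π ^ n).1 m y := by simpa using hn
    have h0 : ∑ z, (π ^ n).1 m z * (h m - h z) = 0 := by
      simp_rw [mul_sub, Finset.sum_sub_distrib, hpow, ← Finset.sum_mul, channel_sum_row]
      ring
    have h1 := (Finset.sum_eq_zero_iff_of_nonneg fun z _ => mul_nonneg ((π ^ n).2.1 m z)
      (sub_nonneg.2 (hm z (Finset.mem_univ z)))).1 h0 y (Finset.mem_univ y)
    linarith [(mul_eq_zero.1 h1).resolve_left hn'.ne']
  rw [key x, key y]

lemma channel_sum_col {q : ℕ} (π : Channel q) (hrev : π.1.IsSymm) (y : Fin q) :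
    ∑ x, π.1 x y = 1 := by
  simp_rw [fun x => hrev.apply y x]
  exact channel_sum_row π y

/-- A solution of the fixed-point equation has the uniform distribution as its mean. For `k = 1` the
mean is harmonic and irreducibility forces it to be constant. For `k ≥ 2` the mean `m` satisfies
`q m = (q π m) ^ k` with `q π m` of average `1`, and the equality case of Bernoulli's inequality
gives `q π m = 1`. -/
lemma fixedPoint_mean {q k : ℕ} [NeZero q] (hk : 1 ≤ k) (π : Channel q) (hrev : π.1.IsSymm)
    (hirr : π.1.IsIrreducible) {Q : Measure (Simplex q)} [IsProbabilityMeasure Q]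
    (hQ : IsFixedPoint k π Q) (x : Fin q) : ∫ η, η.1 x ∂Q = 1 / (q : ℝ) := by
  have hq : (q : ℝ) ≠ 0 := by simp [NeZero.ne q]
  set m : Fin q → ℝ := fun x => ∫ η, η.1 x ∂Q with hm
  have heq : ∀ x, m x = (q : ℝ) ^ (k - 1) * (∑ y, π.1 x y * m y) ^ k := fixedPoint_mean_eq π hQ
  have hm0 : ∀ x, 0 ≤ m x := fun x => integral_nonneg fun η => η.2.1 x
  have hsum : ∑ x, m x = 1 := by
    rw [hm, ← integral_finsetSum _ fun y _ => integrable_simplex_apply Q y]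
    have : ∀ η : Simplex q, ∑ i, η.1 i = 1 := fun η => η.2.2
    simp_rw [this]
    simp
  change m x = _
  rcases hk.eq_or_lt with rfl | hk2
  · have hh : ∀ x, ∑ y, π.1 x y * m y = m x := fun x => by rw [heq x]; simp
    have hc : ∀ y, m y = m x := fun y => harmonic_eq_of_irreducible π hirr hh y x
    simp_rw [hc] at hsum
    rw [Finset.sum_const, Finset.card_univ, Fintype.card_fin, nsmul_eq_mul] at hsum
    field_simp
    linarith
  · set t : Fin q → ℝ := fun x => q * ∑ y, π.1 x y * m y with ht
    have ht0 : ∀ x, 0 ≤ t x := fun x => mul_nonneg (by positivity)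
      (Finset.sum_nonneg fun y _ => mul_nonneg (π.2.1 x y) (hm0 y))
    have htm : ∀ x, q * m x = t x ^ k := by
      intro x
      rw [heq x, ht]
      dsimp only
      rw [mul_pow, ← mul_assoc, ← pow_succ']
      congr 2
      omega
    have hts : ∑ x, t x = q := by
      rw [ht, ← Finset.mul_sum, Finset.sum_comm]
      simp_rw [← Finset.sum_mul, channel_sum_col π hrev]
      simp [hsum]
    have hle : ∑ x, (1 + k * (t x - 1) + (t x - 1) ^ 2) ≤ ∑ x, q * m x :=
      Finset.sum_le_sum fun x _ => (one_add_mul_add_sq_le_pow (ht0 x) hk2).trans (htm x).ge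
    rw [← Finset.mul_sum, hsum, Finset.sum_add_distrib, Finset.sum_add_distrib, ← Finset.mul_sum,
      Finset.sum_sub_distrib, hts] at hle
    simp only [Finset.sum_const, Finset.card_univ, Fintype.card_fin, nsmul_eq_mul, mul_one,
      sub_self, mul_zero, add_zero] at hle
    have h0 : ∑ x, (t x - 1) ^ 2 = 0 :=
      le_antisymm (by linarith) (Finset.sum_nonneg fun _ _ => sq_nonneg _)
    have h1 := (Finset.sum_eq_zero_iff_of_nonneg fun x _ => sq_nonneg _).1 h0 x (Finset.mem_univ x)
    have h2 : t x = 1 := by nlinarith [pow_eq_zero_iff (two_ne_zero) |>.1 h1]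
    have h3 := htm x
    rw [h2, one_pow] at h3
    field_simp
    linarith

/-! ### Tilted measures and the law of the reconstructed distribution -/

lemma measurable_tilt_density {q : ℕ} (x : Fin q) :
    Measurable fun η : Simplex q => ENNReal.ofReal ((q : ℝ) * η.1 x) :=
  ((continuous_simplex_apply x).measurable.const_mul _).ennreal_ofReal

lemma isProbabilityMeasure_tilt {q : ℕ} [NeZero q] {Q : Measure (Simplex q)}
    [IsProbabilityMeasure Q] {x : Fin q} (h : ∫ η, η.1 x ∂Q = 1 / (q : ℝ)) :
    IsProbabilityMeasure (tilt Q x) := by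
  have hq : (q : ℝ) ≠ 0 := by simp [NeZero.ne q]
  refine ⟨?_⟩
  rw [tilt, withDensity_apply _ MeasurableSet.univ, Measure.restrict_univ,
    ← ofReal_integral_eq_lintegral_ofReal ((integrable_simplex_apply Q x).const_mul _)
      (.of_forall fun η => mul_nonneg (by positivity) (η.2.1 x)), integral_const_mul, h]
  rw [mul_one_div_cancel hq, ENNReal.ofReal_one]

/-- The law of the distribution drawn at a child of a vertex of colour `x`. -/
noncomputable def childTilt {q : ℕ} (π : Channel q) (Q : Measure (Simplex q)) (x : Fin q) :
    Measure (Simplex q) :=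
  ∑ y, ENNReal.ofReal (π.1 x y) • tilt Q y

lemma isProbabilityMeasure_childTilt {q : ℕ} (π : Channel q) {Q : Measure (Simplex q)}
    (h : ∀ y, IsProbabilityMeasure (tilt Q y)) (x : Fin q) :
    IsProbabilityMeasure (childTilt π Q x) := by
  refine ⟨?_⟩
  simp only [childTilt, Measure.finsetSum_apply, Measure.smul_apply, measure_univ, smul_eq_mul,
    mul_one]
  rw [← ENNReal.ofReal_sum_of_nonneg (fun y _ => π.2.1 x y), channel_sum_row, ENNReal.ofReal_one]

lemma measurable_childTilt_density {q : ℕ} (π : Channel q) (x : Fin q) :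
    Measurable fun η : Simplex q => ENNReal.ofReal ((q : ℝ) * ∑ y, π.1 x y * η.1 y) :=
  ((continuous_finsetSum _ fun y _ => (continuous_simplex_apply y).const_mul _).measurable.const_mul
    _).ennreal_ofReal

lemma childTilt_eq_withDensity {q : ℕ} (π : Channel q) (Q : Measure (Simplex q)) (x : Fin q) :
    childTilt π Q x
      = Q.withDensity fun η => ENNReal.ofReal ((q : ℝ) * ∑ y, π.1 x y * η.1 y) := by
  ext s hs
  simp only [childTilt, tilt, Measure.finsetSum_apply, Measure.smul_apply, smul_eq_mul]
  rw [withDensity_apply _ hs]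
  simp_rw [withDensity_apply _ hs]
  have : ∀ η : Simplex q, ENNReal.ofReal ((q : ℝ) * ∑ y, π.1 x y * η.1 y)
      = ∑ y, ENNReal.ofReal (π.1 x y) * ENNReal.ofReal ((q : ℝ) * η.1 y) := by
    intro η
    rw [Finset.mul_sum, ENNReal.ofReal_sum_of_nonneg fun y _ =>
      mul_nonneg (by positivity) (mul_nonneg (π.2.1 x y) (η.2.1 y))]
    refine Finset.sum_congr rfl fun y _ => ?_
    rw [← ENNReal.ofReal_mul (π.2.1 x y)]
    congr 1; ring
  simp_rw [this]
  rw [lintegral_finsetSum _ fun y _ => (measurable_tilt_density y).const_mul _]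
  refine Finset.sum_congr rfl fun y _ => ?_
  rw [lintegral_const_mul _ (measurable_tilt_density y)]

/-- A product of measures with densities has the product density. -/
lemma pi_withDensity_eq {ι α : Type*} [Fintype ι] [MeasurableSpace α] (Q : Measure α)
    [IsProbabilityMeasure Q] {f : α → ENNReal} (hf : Measurable f)
    [IsFiniteMeasure (Q.withDensity f)] :
    (Measure.pi fun _ : ι => Q.withDensity f)
      = (Measure.pi fun _ : ι => Q).withDensity fun η => ∏ i, f (η i) := by
  refine Measure.pi_eq fun s hs => ?_
  have hs' : MeasurableSet (Set.univ.pi s) := MeasurableSet.univ_pi hs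
  rw [withDensity_apply _ hs', ← lintegral_indicator hs']
  have e : ∀ η : ι → α, (Set.univ.pi s).indicator (fun η => ∏ i, f (η i)) η
      = ∏ i, (s i).indicator f (η i) := by
    intro η
    by_cases h : η ∈ Set.univ.pi s
    · rw [Set.indicator_of_mem h]
      exact Finset.prod_congr rfl fun i _ => (Set.indicator_of_mem (h i (Set.mem_univ i)) f).symm
    · rw [Set.indicator_of_notMem h]
      obtain ⟨i, hi⟩ : ∃ i, η i ∉ s i := by simpa using h
      exact (Finset.prod_eq_zero (Finset.mem_univ i) (Set.indicator_of_notMem hi f)).symm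
  simp_rw [e]
  have hm : ∀ i, Measurable ((s i).indicator f) := fun i => hf.indicator (hs i)
  rw [lintegral_prod_eq_prod_lintegral_of_indepFun Finset.univ
    (fun i (η : ι → α) => (s i).indicator f (η i))
    (iIndepFun_pi (μ := fun _ : ι => Q) fun i => (hm i).aemeasurable)
    (fun i => (hm i).comp (measurable_pi_apply i))]
  refine Finset.prod_congr rfl fun i _ => ?_
  rw [withDensity_apply _ (hs i), ← lintegral_indicator (hs i)]
  exact ((measurePreserving_eval (fun _ : ι => Q) i).lintegral_comp (hm i))

/-- Merging independent draws at the children of a vertex of colour `x` gives a draw from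
`tilt Q x`: this is the fixed-point equation, conditioned on the colour. -/
lemma map_merge_pi_childTilt {q k : ℕ} [NeZero q] (hk : 1 ≤ k) (π : Channel q)
    {Q : Measure (Simplex q)} [IsProbabilityMeasure Q] (hQ : IsFixedPoint k π Q)
    (ht : ∀ y, IsProbabilityMeasure (tilt Q y)) (x : Fin q) :
    (Measure.pi fun _ : Fin k => childTilt π Q x).map (merge π) = tilt Q x := by
  have hfin := isProbabilityMeasure_childTilt π ht x
  rw [childTilt_eq_withDensity] at hfin ⊢
  rw [pi_withDensity_eq Q (measurable_childTilt_density π x)]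
  refine Measure.ext_of_lintegral _ fun f hf => ?_
  have hprod : Measurable fun η : Fin k → Simplex q =>
      ∏ i, ENNReal.ofReal ((q : ℝ) * ∑ y, π.1 x y * (η i).1 y) :=
    Finset.measurable_prod _ fun i _ =>
      (measurable_childTilt_density π x).comp (measurable_pi_apply i)
  rw [lintegral_map hf (measurable_merge π)]
  refine (lintegral_withDensity_eq_lintegral_mul _ hprod (hf.comp (measurable_merge π))).trans ?_
  rw [tilt, lintegral_withDensity_eq_lintegral_mul _ (measurable_tilt_density x) hf]
  refine Eq.trans ?_ (congrArg (fun ν : Measure (Simplex q) =>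
    ∫⁻ η : Simplex q, ENNReal.ofReal ((q : ℝ) * η.1 x) * f η ∂ν) hQ).symm
  refine Eq.trans ?_ (lintegral_recursionMap k π Q ((measurable_tilt_density x).mul hf)).symm
  refine lintegral_congr fun η => ?_
  simp only [Pi.mul_apply, Function.comp_apply]
  rw [← mul_assoc]
  congr 1
  have hqk : (q : ℝ) ^ k = q * q ^ (k - 1) := by
    rw [← pow_succ']; congr 1; omega
  rw [← ENNReal.ofReal_prod_of_nonneg fun i _ => mul_nonneg (by positivity)
      (Finset.sum_nonneg fun y _ => mul_nonneg (π.2.1 x y) ((η i).2.1 y)),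
    ← ENNReal.ofReal_mul (mul_nonneg (by positivity) (mergeZ_nonneg π η)),
    Finset.prod_mul_distrib]
  congr 1
  have := mergeZ_mul_merge π η x
  rw [mergeWeight] at this
  rw [← this]
  simp only [Finset.prod_const, Finset.card_univ, Fintype.card_fin]
  rw [hqk]
  ring

/-- Averaging the draws at generation `n + 1` over the colours of that generation. -/
lemma sum_levelStep_smul_pi_tilt {q k : ℕ} (π : Channel q) {Q : Measure (Simplex q)}
    (ht : ∀ y, IsProbabilityMeasure (tilt Q y)) (n : ℕ) (b : Config q k n) :
    ∑ c, ENNReal.ofReal (levelStep π n b c) • (Measure.pi fun w => tilt Q (c w))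
      = Measure.pi fun w : Vertex k (n + 1) => childTilt π Q (b fun j => w j.castSucc) := by
  have := isProbabilityMeasure_childTilt π ht
  refine (Measure.pi_eq fun s hs => ?_).symm
  simp only [Measure.finsetSum_apply, Measure.smul_apply, smul_eq_mul, Measure.pi_pi, levelStep,
    childTilt]
  rw [Finset.prod_univ_sum, Fintype.piFinset_univ]
  refine Finset.sum_congr rfl fun c _ => ?_
  rw [ENNReal.ofReal_prod_of_nonneg fun w _ => π.2.1 _ _, Finset.prod_mul_distrib]

/-- A product over generation `n + 1` is a product over the vertices of generation `n` of products
over their children. -/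
lemma map_snoc_pi {q k n : ℕ} (ν : Vertex k n → Measure (Simplex q))
    [∀ v, IsProbabilityMeasure (ν v)] :
    (Measure.pi fun w : Vertex k (n + 1) => ν fun j => w j.castSucc).map
        (fun m v i => m (Fin.snoc (α := fun _ => Fin k) v i))
      = Measure.pi fun v => Measure.pi fun _ : Fin k => ν v := by
  have h1 : (Measure.pi fun w : Vertex k (n + 1) => ν fun j => w j.castSucc)
      = (Measure.pi fun v => Measure.pi fun _ : Fin k => ν v).map
        (fun m (w : Vertex k (n + 1)) => m (fun j => w j.castSucc) (w (Fin.last n))) := by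
    refine Measure.pi_eq fun s hs => ?_
    rw [Measure.map_apply (by fun_prop) (MeasurableSet.univ_pi hs)]
    have e : (fun (m : Vertex k n → Fin k → Simplex q) (w : Vertex k (n + 1)) =>
        m (fun j => w j.castSucc) (w (Fin.last n))) ⁻¹' Set.univ.pi s
        = Set.univ.pi fun v => Set.univ.pi fun i : Fin k =>
          s (Fin.snoc (α := fun _ => Fin k) v i) := by
      ext m
      simp only [Set.mem_preimage, Set.mem_pi, Set.mem_univ, true_imp_iff]
      constructor
      · intro h v i
        simpa using h (Fin.snoc (α := fun _ => Fin k) v i)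
      · intro h w
        have := h (fun j => w j.castSucc) (w (Fin.last n))
        rwa [show Fin.snoc (α := fun _ => Fin k) (fun j => w j.castSucc) (w (Fin.last n)) = w from
          Fin.snoc_init_self w] at this
    rw [e, Measure.pi_pi]
    simp_rw [Measure.pi_pi]
    rw [← (Fin.snocEquiv fun _ : Fin (n + 1) => Fin k).prod_comp, Fintype.prod_prod_type,
      Finset.prod_comm]
    simp [Fin.snocEquiv]
  rw [h1, Measure.map_map (by fun_prop) (by fun_prop)]
  convert Measure.map_id
  funext m v i
  simp

lemma measurable_mergeToRoot {q k : ℕ} [NeZero q] (π : Channel q) (ℓ : ℕ) :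
    Measurable (mergeToRoot (k := k) π ℓ) := by
  induction ℓ with
  | zero => exact measurable_pi_apply _
  | succ ℓ ih =>
    exact ih.comp (measurable_pi_lambda _ fun v => (measurable_merge π).comp
      (measurable_pi_lambda _ fun i => measurable_pi_apply _))

/-- Given that the root has colour `x`, the distribution computed at the root has law `tilt Q x`,
whatever the generation at which the scheme starts. -/
lemma sum_levelLaw_lintegral_mergeToRoot {q k : ℕ} [NeZero q] (hk : 1 ≤ k) (π : Channel q)
    {Q : Measure (Simplex q)} [IsProbabilityMeasure Q] (hQ : IsFixedPoint k π Q)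
    (ht : ∀ y, IsProbabilityMeasure (tilt Q y)) (x : Fin q) (ℓ : ℕ)
    {f : Simplex q → ENNReal} (hf : Measurable f) :
    ∑ c : Config q k ℓ, ENNReal.ofReal (levelLaw π ℓ x c) *
        ∫⁻ m, f (mergeToRoot π ℓ m) ∂(Measure.pi fun v => tilt Q (c v))
      = ∫⁻ η, f η ∂(tilt Q x) := by
  have hR := isProbabilityMeasure_childTilt π ht
  induction ℓ with
  | zero =>
    rw [Finset.sum_eq_single fun _ => x]
    · simp only [levelLaw, if_true, ENNReal.ofReal_one, one_mul, mergeToRoot]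
      exact (measurePreserving_eval (fun _ : Vertex k 0 => tilt Q x) Fin.elim0).lintegral_comp hf
    · intro c _ hc
      simp [levelLaw, hc]
    · simp
  | succ ℓ ih =>
    rw [← ih]
    have hstep : ∀ b : Config q k ℓ,
        ∑ c, ENNReal.ofReal (levelStep π ℓ b c) *
          ∫⁻ m, f (mergeToRoot π (ℓ + 1) m) ∂(Measure.pi fun w => tilt Q (c w))
        = ∫⁻ m, f (mergeToRoot π ℓ m) ∂(Measure.pi fun v => tilt Q (b v)) := by
      intro b
      simp_rw [← smul_eq_mul, ← lintegral_smul_measure]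
      rw [← lintegral_finsetSum_measure, sum_levelStep_smul_pi_tilt π ht]
      have hs := map_snoc_pi (k := k) (fun v : Vertex k ℓ => childTilt π Q (b v))
      have hm := Measure.pi_map_pi (μ := fun v : Vertex k ℓ =>
        Measure.pi fun _ : Fin k => childTilt π Q (b v)) (f := fun _ => merge π)
        (hμ := fun v => by
          rw [map_merge_pi_childTilt hk π hQ ht]; infer_instance)
        (fun _ => (measurable_merge π).aemeasurable)
      simp_rw [map_merge_pi_childTilt hk π hQ ht] at hm
      have hmm : Measurable fun (r : Vertex k ℓ → Fin k → Simplex q) v => merge π (r v) :=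
        measurable_pi_lambda _ fun v => (measurable_merge π).comp (measurable_pi_apply v)
      rw [← hm, ← hs]
      exact ((lintegral_map (hf.comp (measurable_mergeToRoot π ℓ)) hmm).trans
        (lintegral_map ((hf.comp (measurable_mergeToRoot π ℓ)).comp hmm) (by fun_prop))).symm
    simp_rw [← hstep, levelLaw, Finset.mul_sum]
    rw [Finset.sum_comm]
    refine Finset.sum_congr rfl fun c _ => ?_
    rw [ENNReal.ofReal_sum_of_nonneg fun b _ =>
      mul_nonneg (levelLaw_nonneg π ℓ x b) (levelStep_nonneg π ℓ b c), Finset.sum_mul]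
    refine Finset.sum_congr rfl fun b _ => ?_
    rw [ENNReal.ofReal_mul (levelLaw_nonneg π ℓ x b), mul_assoc]

/-! ### The success probability of the scheme -/

lemma draw_singleton {q : ℕ} (η : Simplex q) (y : Fin q) :
    draw η {y} = ENNReal.ofReal (η.1 y) := by
  simp only [draw, Measure.finsetSum_apply, Measure.smul_apply, smul_eq_mul]
  rw [Finset.sum_eq_single y]
  · simp
  · intro z _ hz
    simp [Measure.dirac_apply' _ (measurableSet_singleton y), hz]
  · simp

instance {q : ℕ} (η : Simplex q) : IsProbabilityMeasure (draw η) := by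
  refine ⟨?_⟩
  simp only [draw, Measure.finsetSum_apply, Measure.smul_apply, measure_univ, smul_eq_mul, mul_one]
  rw [← ENNReal.ofReal_sum_of_nonneg (fun y _ => η.2.1 y), η.2.2, ENNReal.ofReal_one]

lemma measurable_draw {q : ℕ} : Measurable (draw : Simplex q → Measure (Fin q)) := by
  refine Measure.measurable_of_measurable_coe _ fun s _ => ?_
  simp only [draw, Measure.finsetSum_apply, Measure.smul_apply, smul_eq_mul]
  exact Finset.measurable_sum _ fun y _ =>
    ((continuous_simplex_apply y).measurable.ennreal_ofReal).mul_const _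

lemma guessLaw_apply {q k : ℕ} [NeZero q] (π : Channel q) (Q : Measure (Simplex q)) (ℓ : ℕ)
    (c : Config q k ℓ) (s : Set (Fin q)) :
    guessLaw π Q ℓ c s
      = ∫⁻ m, draw (mergeToRoot π ℓ m) s ∂(Measure.pi fun v => tilt Q (c v)) :=
  Measure.bind_apply MeasurableSet.of_discrete
    (measurable_draw.comp (measurable_mergeToRoot π ℓ)).aemeasurable

lemma isProbabilityMeasure_guessLaw {q k : ℕ} [NeZero q] (π : Channel q)
    {Q : Measure (Simplex q)} (ht : ∀ y, IsProbabilityMeasure (tilt Q y)) (ℓ : ℕ)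
    (c : Config q k ℓ) : IsProbabilityMeasure (guessLaw π Q ℓ c) := by
  refine ⟨?_⟩
  rw [guessLaw_apply]
  simp

lemma integrable_simplex_sq {q : ℕ} (Q : Measure (Simplex q)) [IsFiniteMeasure Q] (x : Fin q) :
    Integrable (fun η : Simplex q => η.1 x ^ 2) Q := by
  refine Integrable.of_bound ((continuous_simplex_apply x).pow 2).measurable.aestronglyMeasurable 1
    (.of_forall fun η => ?_)
  rw [Real.norm_of_nonneg (sq_nonneg _)]
  exact pow_le_one₀ (η.2.1 x) (simplex_apply_le_one η x)

/-- The success probability does not depend on the generation: the distribution computed at the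
root has law `tilt Q x` given the root colour `x`, and the guess is `x` with probability `η x`. -/
lemma successProb_guessLaw {q k : ℕ} [NeZero q] (hk : 1 ≤ k) (π : Channel q)
    {Q : Measure (Simplex q)} [IsProbabilityMeasure Q] (hQ : IsFixedPoint k π Q)
    (ht : ∀ y, IsProbabilityMeasure (tilt Q y)) (ℓ : ℕ) :
    successProb k π ℓ (guessLaw π Q ℓ) = ∑ x, ∫ η, η.1 x ^ 2 ∂Q := by
  have hq : (q : ℝ) ≠ 0 := by simp [NeZero.ne q]
  have hg := isProbabilityMeasure_guessLaw (k := k) π ht ℓ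
  rw [successProb, integral_root_level π ℓ fun x c => (guessLaw π Q ℓ c).real {x}]
  refine Finset.sum_congr rfl fun x _ => ?_
  have hm : Measurable fun η : Simplex q => ENNReal.ofReal (η.1 x) :=
    (continuous_simplex_apply x).measurable.ennreal_ofReal
  have h := sum_levelLaw_lintegral_mergeToRoot hk π hQ ht x ℓ hm
  have e : ∀ c : Config q k ℓ, ∫⁻ m, ENNReal.ofReal ((mergeToRoot π ℓ m).1 x)
      ∂(Measure.pi fun v => tilt Q (c v)) = guessLaw π Q ℓ c {x} := fun c => by
    rw [guessLaw_apply]; simp_rw [draw_singleton]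
  simp_rw [e] at h
  rw [tilt, lintegral_withDensity_eq_lintegral_mul _ (measurable_tilt_density x) hm] at h
  have e2 : ∀ η : Simplex q, ((fun η : Simplex q => ENNReal.ofReal ((q : ℝ) * η.1 x)) *
      fun η : Simplex q => ENNReal.ofReal (η.1 x)) η = ENNReal.ofReal ((q : ℝ) * η.1 x ^ 2) := by
    intro η
    rw [Pi.mul_apply, ← ENNReal.ofReal_mul (mul_nonneg (by positivity) (η.2.1 x))]
    congr 1; ring
  simp_rw [e2] at h
  rw [← ofReal_integral_eq_lintegral_ofReal ((integrable_simplex_sq Q x).const_mul _)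
    (.of_forall fun η => by positivity), integral_const_mul] at h
  have h' := congrArg ENNReal.toReal h
  rw [ENNReal.toReal_sum fun c _ => ENNReal.mul_ne_top ENNReal.ofReal_ne_top (measure_ne_top _ _),
    ENNReal.toReal_ofReal (mul_nonneg (by positivity) (integral_nonneg fun η => sq_nonneg _))] at h'
  simp_rw [ENNReal.toReal_mul, ENNReal.toReal_ofReal (levelLaw_nonneg π ℓ x _),
    ← measureReal_def] at h'
  simp_rw [mul_assoc]
  rw [← Finset.mul_sum, h']
  field_simp

lemma isTrivial_of_ae_eq {q : ℕ} [NeZero q] {Q : Measure (Simplex q)} [IsProbabilityMeasure Q]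
    (h : ∀ᵐ η ∂Q, η = unif q) : IsTrivial Q := by
  have h1 : Q.map id = Q.map fun _ => unif q := Measure.map_congr h
  rw [Measure.map_id, Measure.map_const, measure_univ, one_smul] at h1
  exact h1

lemma eq_unif_of_forall {q : ℕ} [NeZero q] {η : Simplex q} (h : ∀ x, η.1 x = 1 / (q : ℝ)) :
    η = unif q := Subtype.ext (funext h)

/-- The sum of the squares `η x ^ 2` exceeds `1 / q` by the squared distance of `η` to the uniform
distribution. -/
lemma one_div_lt_sum_integral_sq {q : ℕ} [NeZero q] {Q : Measure (Simplex q)}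
    [IsProbabilityMeasure Q] (hQ : ¬ IsTrivial Q) :
    1 / (q : ℝ) < ∑ x, ∫ η, η.1 x ^ 2 ∂Q := by
  have hq : (q : ℝ) ≠ 0 := by simp [NeZero.ne q]
  have e : ∀ η : Simplex q, ∑ x, η.1 x ^ 2 = 1 / (q : ℝ) + ∑ x, (η.1 x - 1 / (q : ℝ)) ^ 2 := by
    intro η
    have h1 : ∑ x, η.1 x = 1 := η.2.2
    simp_rw [sub_sq, Finset.sum_add_distrib, Finset.sum_sub_distrib]
    rw [← Finset.sum_mul, ← Finset.mul_sum, h1]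
    simp only [Finset.sum_const, Finset.card_univ, Fintype.card_fin, nsmul_eq_mul]
    field_simp
    ring
  have hi : Integrable (fun η : Simplex q => ∑ x, η.1 x ^ 2) Q :=
    integrable_finsetSum _ fun x _ => integrable_simplex_sq Q x
  have hi2 : Integrable (fun η : Simplex q => ∑ x, (η.1 x - 1 / (q : ℝ)) ^ 2) Q := by
    have := hi.sub (integrable_const (1 / (q : ℝ)))
    refine this.congr (.of_forall fun η => ?_)
    simp only [Pi.sub_apply, e]
    ring
  rw [← integral_finsetSum _ fun x _ => integrable_simplex_sq Q x]
  simp_rw [e]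
  rw [integral_add (integrable_const _) hi2, integral_const, probReal_univ, one_smul]
  have h0 : 0 ≤ fun η : Simplex q => ∑ x, (η.1 x - 1 / (q : ℝ)) ^ 2 :=
    fun η => Finset.sum_nonneg fun x _ => sq_nonneg _
  have hpos : 0 < ∫ η, ∑ x, ((η : Simplex q).1 x - 1 / (q : ℝ)) ^ 2 ∂Q := by
    refine (integral_nonneg h0).lt_of_ne fun hz => hQ (isTrivial_of_ae_eq ?_)
    filter_upwards [(integral_eq_zero_iff_of_nonneg h0 hi2).1 hz.symm] with η hη
    refine eq_unif_of_forall fun x => ?_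
    have := (Finset.sum_eq_zero_iff_of_nonneg fun x _ => sq_nonneg _).1 hη x (Finset.mem_univ x)
    linarith [(pow_eq_zero_iff two_ne_zero).1 this]
  linarith

/-! ### Mutual information -/

/-- The relative entropy, in bits, of a distribution with respect to the uniform distribution,
written with the nonnegative function `klFun t = t log t + 1 - t` so that its sign and its zeros are
plain. -/
noncomputable def relEntropyUnif {q : ℕ} (η : Simplex q) : ℝ :=
  (∑ y, (1 / (q : ℝ)) * InformationTheory.klFun (q * η.1 y)) / Real.log 2

lemma continuous_relEntropyUnif {q : ℕ} : Continuous (relEntropyUnif : Simplex q → ℝ) :=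
  (continuous_finsetSum _ fun y _ => continuous_const.mul
    (InformationTheory.continuous_klFun.comp
      (continuous_const.mul (continuous_simplex_apply y)))).div_const _

lemma relEntropyUnif_nonneg {q : ℕ} (η : Simplex q) : 0 ≤ relEntropyUnif η :=
  div_nonneg (Finset.sum_nonneg fun y _ => mul_nonneg (by positivity)
    (InformationTheory.klFun_nonneg (mul_nonneg (by positivity) (η.2.1 y))))
    (Real.log_nonneg one_le_two)

lemma relEntropyUnif_eq_zero_iff {q : ℕ} [NeZero q] (η : Simplex q) :
    relEntropyUnif η = 0 ↔ η = unif q := by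
  have hq : (q : ℝ) ≠ 0 := by simp [NeZero.ne q]
  constructor
  · intro h
    have h1 := (div_eq_zero_iff.1 h).resolve_right (Real.log_pos one_lt_two).ne'
    refine eq_unif_of_forall fun x => ?_
    have hx := (Finset.sum_eq_zero_iff_of_nonneg fun y _ => mul_nonneg (by positivity)
      (InformationTheory.klFun_nonneg (mul_nonneg (by positivity) (η.2.1 y)))).1 h1 x
      (Finset.mem_univ x)
    have hx2 := (mul_eq_zero.1 hx).resolve_left (one_div_ne_zero hq)
    rw [InformationTheory.klFun_eq_zero_iff (mul_nonneg (by positivity) (η.2.1 x))] at hx2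
    rw [eq_div_iff hq]
    linarith
  · rintro rfl
    simp [relEntropyUnif, unif, mul_inv_cancel₀ hq, InformationTheory.klFun_one]

lemma relEntropyUnif_eq {q : ℕ} [NeZero q] (η : Simplex q) :
    relEntropyUnif η = ∑ y, η.1 y * Real.logb 2 (q * η.1 y) := by
  have hq : (q : ℝ) ≠ 0 := by simp [NeZero.ne q]
  have h1 : ∑ x, η.1 x = 1 := η.2.2
  have e : ∀ y, (1 / (q : ℝ)) * InformationTheory.klFun (q * η.1 y)
      = η.1 y * Real.log (q * η.1 y) + (1 / (q : ℝ) - η.1 y) := fun y => by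
    rw [InformationTheory.klFun_apply]
    field_simp
    ring
  simp_rw [relEntropyUnif, e, Finset.sum_add_distrib, Finset.sum_sub_distrib, h1, Real.logb,
    ← mul_div_assoc, ← Finset.sum_div]
  simp [hq]

lemma real_rootColor {q k : ℕ} [NeZero q] (π : Channel q) (x : Fin q) :
    (broadcast k π).real {ω | rootColor ω = x} = 1 / (q : ℝ) := by
  classical
  rw [← integral_indicator_one (measurableSet_rootColor_eq x)]
  have h := integral_comp_root (k := k) π (fun c => if c Fin.elim0 = x then (1 : ℝ) else 0)
  rw [Finset.sum_eq_single x] at h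
  · simp only [if_true, mul_one] at h
    rw [← h]
    refine integral_congr_ae (.of_forall fun ω => ?_)
    simp [Set.indicator_apply, rootColor]
  · intro y _ hy; simp [hy]
  · simp

/-- The mutual information is the mean relative entropy of the posterior. -/
lemma mutualInfo_eq_integral {q k : ℕ} [NeZero q] (π : Channel q) (ℓ : ℕ) :
    mutualInfo k π ℓ = ∫ ω, relEntropyUnif (rootPosterior k π ℓ (ω ℓ)) ∂(broadcast k π) := by
  have hq : (q : ℝ) ≠ 0 := by simp [NeZero.ne q]
  rw [integral_level π ℓ fun c => relEntropyUnif (rootPosterior k π ℓ c), mutualInfo,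
    Finset.sum_comm]
  refine Finset.sum_congr rfl fun c _ => ?_
  rw [relEntropyUnif_eq, Finset.mul_sum]
  refine Finset.sum_congr rfl fun x _ => ?_
  rw [real_root_inter_level, real_level, real_rootColor, ← levelProb_mul_rootPosterior]
  by_cases h : levelProb π ℓ c = 0
  · simp [h]
  · rw [mul_assoc]
    congr 3
    field_simp

lemma tendsto_mutualInfo {q k : ℕ} [NeZero q] (π : Channel q)
    {ηlim : (Π n, Config q k n) → Simplex q}
    (hlim : ∀ᵐ ω ∂(broadcast k π),
      Tendsto (fun ℓ => rootPosterior k π ℓ (ω ℓ)) atTop (𝓝 (ηlim ω))) :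
    Tendsto (mutualInfo k π) atTop (𝓝 (∫ ω, relEntropyUnif (ηlim ω) ∂(broadcast k π))) := by
  obtain ⟨C, hC⟩ := isCompact_univ.bddAbove_image (continuous_relEntropyUnif (q := q)).continuousOn
  have h : mutualInfo k π
      = fun ℓ => ∫ ω, relEntropyUnif (rootPosterior k π ℓ (ω ℓ)) ∂(broadcast k π) :=
    funext fun ℓ => mutualInfo_eq_integral π ℓ
  rw [h]
  refine tendsto_integral_of_dominated_convergence (fun _ => C)
    (fun ℓ => (continuous_relEntropyUnif.measurable.comp
      (measurable_rootPosterior π ℓ)).aestronglyMeasurable)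
    (integrable_const _) (fun ℓ => .of_forall fun ω => ?_) ?_
  · rw [Real.norm_of_nonneg (relEntropyUnif_nonneg _)]
    exact hC ⟨_, Set.mem_univ _, rfl⟩
  · filter_upwards [hlim] with ω hω
    exact (continuous_relEntropyUnif.tendsto _).comp hω

/-- Reconstruction is solvable exactly when the limiting posterior is not almost surely uniform. -/
lemma solvable_iff {q k : ℕ} [NeZero q] (π : Channel q)
    {ηlim : (Π n, Config q k n) → Simplex q} (hm : Measurable ηlim)
    (hlim : ∀ᵐ ω ∂(broadcast k π),
      Tendsto (fun ℓ => rootPosterior k π ℓ (ω ℓ)) atTop (𝓝 (ηlim ω))) :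
    Solvable k π ↔ ¬ ∀ᵐ ω ∂(broadcast k π), ηlim ω = unif q := by
  have ht := tendsto_mutualInfo π hlim
  obtain ⟨C, hC⟩ := isCompact_univ.bddAbove_image (continuous_relEntropyUnif (q := q)).continuousOn
  have hint : Integrable (fun ω => relEntropyUnif (ηlim ω)) (broadcast k π) :=
    Integrable.of_bound (continuous_relEntropyUnif.measurable.comp hm).aestronglyMeasurable C
      (.of_forall fun ω => by
        rw [Real.norm_of_nonneg (relEntropyUnif_nonneg _)]
        exact hC ⟨_, Set.mem_univ _, rfl⟩)
  have h0 : 0 ≤ fun ω : Π n, Config q k n => relEntropyUnif (ηlim ω) :=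
    fun ω => relEntropyUnif_nonneg _
  have hz : ∫ ω, relEntropyUnif (ηlim ω) ∂(broadcast k π) = 0 ↔
      ∀ᵐ ω ∂(broadcast k π), ηlim ω = unif q := by
    rw [integral_eq_zero_iff_of_nonneg h0 hint]
    exact eventually_congr (.of_forall fun ω => relEntropyUnif_eq_zero_iff _)
  rw [← hz]
  constructor
  · rintro ⟨I, hI, hIt⟩ h
    rw [tendsto_nhds_unique hIt ht, h] at hI
    exact hI.false
  · intro h
    exact ⟨_, (integral_nonneg h0).lt_of_ne (Ne.symm h), ht⟩

lemma isTrivial_map_iff {q k : ℕ} [NeZero q] (π : Channel q)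
    {ηlim : (Π n, Config q k n) → Simplex q} (hm : Measurable ηlim) :
    IsTrivial ((broadcast k π).map ηlim) ↔ ∀ᵐ ω ∂(broadcast k π), ηlim ω = unif q := by
  have hp : IsProbabilityMeasure ((broadcast k π).map ηlim) :=
    Measure.isProbabilityMeasure_map hm.aemeasurable
  have hs : MeasurableSet {η : Simplex q | η = unif q} := measurableSet_singleton _
  rw [← ae_map_iff hm.aemeasurable hs]
  refine ⟨fun h => ?_, isTrivial_of_ae_eq⟩
  rw [IsTrivial] at h
  rw [h, ae_dirac_iff hs]

/-! ### Guesses when the limiting posterior is uniform -/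

/-- If the limiting posterior is uniform, no sequence of guesses beats a blind guess in the
limit. -/
lemma tendsto_successProb {q k : ℕ} [NeZero q] (π : Channel q)
    (hlim : ∀ᵐ ω ∂(broadcast k π),
      Tendsto (fun ℓ => rootPosterior k π ℓ (ω ℓ)) atTop (𝓝 (unif q)))
    (κ : ∀ ℓ, Config q k ℓ → Measure (Fin q)) (hκ : ∀ ℓ c, IsProbabilityMeasure (κ ℓ c)) :
    Tendsto (fun ℓ => successProb k π ℓ (κ ℓ)) atTop (𝓝 (1 / (q : ℝ))) := by
  have e : ∀ ℓ, successProb k π ℓ (κ ℓ) = ∫ ω,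
      ∑ x, (rootPosterior k π ℓ (ω ℓ)).1 x * (κ ℓ (ω ℓ)).real {x} ∂(broadcast k π) := fun ℓ =>
    integral_root_eq_integral_posterior π ℓ fun x c => (κ ℓ c).real {x}
  simp_rw [e]
  have hsum : ∀ ℓ (c : Config q k ℓ), ∑ x, (κ ℓ c).real {x} = 1 := fun ℓ c => by
    have := hκ ℓ c
    rw [sum_measureReal_singleton, Finset.coe_univ, probReal_univ]
  have hone : 1 / (q : ℝ) = ∫ _ω, (1 / (q : ℝ)) ∂(broadcast k π) := by simp
  rw [hone]
  refine tendsto_integral_of_dominated_convergence (fun _ => 1) (fun ℓ => ?_)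
    (integrable_const _) (fun ℓ => .of_forall fun ω => ?_) ?_
  · exact ((Measurable.of_discrete (f := fun c : Config q k ℓ =>
      ∑ x, (rootPosterior k π ℓ c).1 x * (κ ℓ c).real {x})).comp
        (measurable_pi_apply ℓ)).aestronglyMeasurable
  · rw [Real.norm_of_nonneg (Finset.sum_nonneg fun x _ =>
      mul_nonneg ((rootPosterior k π ℓ (ω ℓ)).2.1 x) measureReal_nonneg)]
    rw [← hsum ℓ (ω ℓ)]
    exact Finset.sum_le_sum fun x _ => mul_le_of_le_one_left measureReal_nonneg
      (simplex_apply_le_one _ x)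
  · filter_upwards [hlim] with ω hω
    have hx : ∀ x, Tendsto (fun ℓ => ((rootPosterior k π ℓ (ω ℓ)).1 x - 1 / (q : ℝ)) *
        (κ ℓ (ω ℓ)).real {x}) atTop (𝓝 0) := by
      intro x
      have h1 : Tendsto (fun ℓ => (rootPosterior k π ℓ (ω ℓ)).1 x - 1 / (q : ℝ)) atTop (𝓝 0) := by
        have := (((continuous_simplex_apply x).tendsto _).comp hω).sub_const (1 / (q : ℝ))
        simpa [unif] using this
      refine squeeze_zero_norm (fun ℓ => ?_) (tendsto_zero_iff_norm_tendsto_zero.1 h1)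
      have := hκ ℓ (ω ℓ)
      rw [norm_mul, Real.norm_of_nonneg (measureReal_nonneg (μ := κ ℓ (ω ℓ)))]
      exact mul_le_of_le_one_right (norm_nonneg _) measureReal_le_one
    have hs := (tendsto_finsetSum Finset.univ fun x _ => hx x).const_add (1 / (q : ℝ))
    simp only [Finset.sum_const_zero, add_zero] at hs
    refine hs.congr fun ℓ => ?_
    simp_rw [sub_mul, Finset.sum_sub_distrib, ← Finset.mul_sum, hsum]
    ring

end TreeRecon

theorem mainTheorem1 (q k : ℕ) [NeZero q] (hk : 1 ≤ k) (π : Channel q)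
    (hrev : π.1.IsSymm) (hirr : π.1.IsIrreducible) :
    (AdmitsGlassPhase k π ↔ Solvable k π) ∧
    (∃ ηlim : (Π n, Config q k n) → Simplex q, Measurable ηlim ∧
      (∀ᵐ ω ∂(broadcast k π),
        Tendsto (fun ℓ => rootPosterior k π ℓ (ω ℓ)) atTop (𝓝 (ηlim ω))) ∧
      IsFixedPoint k π ((broadcast k π).map ηlim) ∧
      (Solvable k π → ¬ IsTrivial ((broadcast k π).map ηlim))) ∧
    (∀ Q : Measure (Simplex q), IsProbabilityMeasure Q → IsFixedPoint k π Q → ¬ IsTrivial Q →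
      1 / (q : ℝ) < ∑ x, ∫ η, η.1 x ^ 2 ∂Q ∧
      ∀ ℓ : ℕ, (∀ c : Config q k ℓ, IsProbabilityMeasure (guessLaw π Q ℓ c)) ∧
        successProb k π ℓ (guessLaw π Q ℓ) = ∑ x, ∫ η, η.1 x ^ 2 ∂Q) := by
  obtain ⟨ηlim, hm, hlim⟩ := exists_posterior_limit k π
  have hfix := isFixedPoint_map_limit hk π hm hlim
  have hsol : Solvable k π ↔ ¬ IsTrivial ((broadcast k π).map ηlim) := by
    rw [solvable_iff π hm hlim, isTrivial_map_iff π hm]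
  have htilt : ∀ Q : Measure (Simplex q), IsProbabilityMeasure Q → IsFixedPoint k π Q →
      ∀ y, IsProbabilityMeasure (tilt Q y) := fun Q hQ hF y =>
    isProbabilityMeasure_tilt (fixedPoint_mean hk π hrev hirr hF y)
  refine ⟨⟨?_, fun h => ?_⟩, ⟨ηlim, hm, hlim, hfix, hsol.1⟩, ?_⟩
  · rintro ⟨Q, hQ, hF, hnt⟩
    rw [solvable_iff π hm hlim]
    intro hu
    have ht := htilt Q hQ hF
    have hlim' : ∀ᵐ ω ∂(broadcast k π),
        Tendsto (fun ℓ => rootPosterior k π ℓ (ω ℓ)) atTop (𝓝 (unif q)) := by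
      filter_upwards [hlim, hu] with ω h1 h2
      rwa [h2] at h1
    -- the success probability of the scheme built on `Q` does not decay to that of a blind guess
    have h1 := tendsto_successProb π hlim' (fun ℓ => guessLaw π Q ℓ)
      fun ℓ => isProbabilityMeasure_guessLaw π ht ℓ
    simp_rw [successProb_guessLaw hk π hF ht] at h1
    exact (one_div_lt_sum_integral_sq hnt).ne (tendsto_nhds_unique tendsto_const_nhds h1).symm
  · exact ⟨_, Measure.isProbabilityMeasure_map hm.aemeasurable, hfix, hsol.1 h⟩
  · intro Q hQ hF hnt
    have ht := htilt Q hQ hF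
    exact ⟨one_div_lt_sum_integral_sq hnt, fun ℓ =>
      ⟨isProbabilityMeasure_guessLaw π ht ℓ, successProb_guessLaw hk π hF ht ℓ⟩⟩
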